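/- Let $g$ be an entire function with $g(0)\neq 0$ that has at least one zero; let $Z(g)$ be its set of zeros and $r_0=\min\{|a|:a\in Z(g)\}$. Let $p_n$ be the Appell polynomials of $g$, defined by $e^{xt}/g(t)=\sum_{n\ge 0}p_n(x)t^n$ for $t$ near $0$, and put $$f_n(x)=\frac{\sqrt{2\pi n}\;p_n(nx)}{(xe)^n},\qquad \phi(x)=xe^{1-x}.$$ Let $\mathcal S=\{x:|x|\le 1,\ |\phi(x)|=1\}$ be the Szegő curve; its interior is $\{x:|x|<1,\ |\phi(x)|<1\}$. A zero $a$ of $g$ is called dominant if $|a|=r_0$ or if $1/a$ does not lie in the interior of $\frac1b\mathcal S$ for any $b\in Z(g)$ with $|b|=r_0$. There are finitely many dominant zeros; let $\Phi(x)=\max\{|\phi(ax)|^{-1}: a \text{ dominant}\}$ (with $\Phi(0)=\infty$), and let $D_0$ be the closure of the connected component containing $0$ of $\{x\in\mathbb C:\Phi(x)\neq 1\}$. For a dominant zero $a$ let $$D_a=\{x\in D_0:\ |\phi(ax)|\le|\phi(bx)| \text{ for all dominant } b\ne a,\ |\phi(ax)|\le 1,\ |ax|\le 1\}.$$ Write $D(c;r)$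 for the open disk with centre $c$ and radius $r$. Let $\rho>0$ be different from $|a|$ for every $a\in Z(g)$ and such that $\overline D(0;1/\rho)$ is contained in the interior of $D_0$. For every $a\in Z(g)$ with $|a|<\rho$ let $\delta_a>0$, such that the disks $D(1/a;\delta_a)$, $|a|<\rho$, are mutually disjoint, and let $$R_\rho=\{x:\ \Re(ax)<1 \text{ for all } a\in Z(g) \text{ with } |a|=r_0\}\setminus\Big[\bigcup_{a\in Z(g),\,|a|<\rho}D(1/a;\delta_a)\ \cup\ D(0;1/\rho)\Big].$$ Then the following limits hold uniformly on every compact subset $K$ of the indicated sets; in each case $f_n$ has no zero on $K$ for all sufficiently large $n$. 1. On $\{|x|>1/r_0\}$: $\displaystyle\lim_{n\to\infty}\tfrac1n\ln|f_n(x)|=0$. 2. On $R_\rho\setminus D_0$: $\displaystyle\lim_{n\to\infty}\tfrac1n\ln|f_n(x)|=0$. 3. For every dominant zero $a$ of $g$, on $\mathrm{Int}(D_a)\cap\{|x|>1/\rho\}$: $\displaystyle\lim_{n\to\infty}\tfrac1n\ln|f_n(x)|=-\ln|\phi(ax)|$. -/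

import Mathlib

open Filter Topology

namespace AppellSzego

noncomputable section

/-- `Z(g)`, the set of zeros of `g`. -/
def zeros (g : ℂ → ℂ) : Set ℂ := {a | g a = 0}

/-- `r₀`, the smallest modulus of a zero of `g`
(the infimum is attained when `g` is entire and has a zero). -/
def r0 (g : ℂ → ℂ) : ℝ := sInf ((fun a : ℂ => ‖a‖) '' zeros g)

/-- The value at `x` of the `n`-th Appell polynomial `p_n` with generating function `g`: the
coefficient of `t ^ n` in the expansion of `t ↦ exp (x t) / g t` at `t = 0`. -/
def appell (g : ℂ → ℂ) (n : ℕ) (x : ℂ) : ℂ :=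
  iteratedDeriv n (fun t : ℂ => Complex.exp (x * t) / g t) 0 / (n.factorial : ℂ)

/-- The generating relation `exp (x t) / g t = ∑ p_n(x) t ^ n`. -/
theorem appell_hasSum {g : ℂ → ℂ} (hg : Differentiable ℂ g) {r : ℝ} (x : ℂ)
    (h0 : ∀ t ∈ Metric.ball (0 : ℂ) r, g t ≠ 0) {t : ℂ} (ht : t ∈ Metric.ball (0 : ℂ) r) :
    HasSum (fun n : ℕ => appell g n x * t ^ n) (Complex.exp (x * t) / g t) := by
  have hd : DifferentiableOn ℂ (fun t : ℂ => Complex.exp (x * t) / g t) (Metric.ball 0 r) := by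
    intro s hs
    have h1 : DifferentiableAt ℂ (fun t : ℂ => Complex.exp (x * t)) s := by fun_prop
    exact (h1.div (hg s) (h0 s hs)).differentiableWithinAt
  have h := Complex.hasSum_taylorSeries_on_ball hd ht
  have he : (fun n : ℕ => appell g n x * t ^ n) = fun n : ℕ => ((n.factorial : ℂ)⁻¹ •
      (t - 0) ^ n • iteratedDeriv n (fun t : ℂ => Complex.exp (x * t) / g t) 0) := by
    funext n
    simp only [appell, sub_zero, smul_eq_mul]
    ring
  rw [he]
  exact h

/-- The normalized polynomials `f_n(x) = √(2πn) p_n(n x) / (x e) ^ n`. -/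
def fnorm (g : ℂ → ℂ) (n : ℕ) (x : ℂ) : ℂ :=
  (Real.sqrt (2 * Real.pi * n) : ℂ) * appell g n (n * x) / (x * Complex.exp 1) ^ n

/-- `φ(x) = x e^{1 - x}`. -/
def phi (x : ℂ) : ℂ := x * Complex.exp (1 - x)

/-- The interior of the Szegő curve `{|φ(x)| = 1, |x| ≤ 1}`. -/
def szegoInterior : Set ℂ := {x | ‖x‖ < 1 ∧ ‖phi x‖ < 1}

/-- `a` is a dominant zero of `g`: it has minimal modulus, or `1 / a` is not in the interior of
any of the Szegő curves `(1 / b) 𝒮`, where `b` is a zero of minimal modulus. -/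
def IsDominant (g : ℂ → ℂ) (a : ℂ) : Prop :=
  a ∈ zeros g ∧
    (‖a‖ = r0 g ∨ ∀ b ∈ zeros g, ‖b‖ = r0 g → b * (1 / a) ∉ szegoInterior)

/-- `Φ(x)`, the maximum of `|φ(a x)|⁻¹` over the (finitely many) dominant zeros `a`;
it is infinite at `x = 0`. -/
def Phi (g : ℂ → ℂ) (x : ℂ) : ENNReal :=
  ⨆ a ∈ {a | IsDominant g a}, (‖phi (a * x)‖ₑ)⁻¹

/-- `D₀`, the closure of the connected component containing `0` of the complement of the level
curve `Φ = 1`. -/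
def D0 (g : ℂ → ℂ) : Set ℂ := closure (connectedComponentIn {x | Phi g x ≠ 1} 0)

/-- `D_a`: the points of `D₀` in the closed region bounded by the Szegő curve `(1 / a) 𝒮` at which
`|φ(a x)| ≤ |φ(b x)|` for every dominant zero `b ≠ a`. -/
def Da (g : ℂ → ℂ) (a : ℂ) : Set ℂ :=
  {x ∈ D0 g | (∀ b, IsDominant g b → b ≠ a → ‖phi (a * x)‖ ≤ ‖phi (b * x)‖) ∧
    ‖phi (a * x)‖ ≤ 1 ∧ ‖a * x‖ ≤ 1}

/-- `R_ρ`: the intersection of the half-planes `Re (a x) < 1`, `a` a zero of minimal modulus,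
with the disks `D(1/a; δ_a)` (`a` a zero, `|a| < ρ`) and the disk `D(0; 1/ρ)` removed. -/
def Rrho (g : ℂ → ℂ) (ρ : ℝ) (δ : ℂ → ℝ) : Set ℂ :=
  {x | ∀ a ∈ zeros g, ‖a‖ = r0 g → (a * x).re < 1} \
    ((⋃ a ∈ {a ∈ zeros g | ‖a‖ < ρ}, Metric.ball (1 / a) (δ a)) ∪ Metric.ball 0 (1 / ρ))

/-- `(1/n) ln |f_n| → L` uniformly on the compact subsets of `U`. As `Real.log 0 = 0`, the
logarithms are also required to be genuine: on each compact subset of `U`, `f_n` has no zero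
once `n` is large. -/
def LogLimitOn (f : ℕ → ℂ → ℂ) (L : ℂ → ℝ) (U : Set ℂ) : Prop :=
  ∀ K : Set ℂ, K ⊆ U → IsCompact K →
    (∀ᶠ n : ℕ in atTop, ∀ x ∈ K, f n x ≠ 0) ∧
    TendstoUniformlyOn (fun (n : ℕ) (x : ℂ) => 1 / (n : ℝ) * Real.log ‖f n x‖) L atTop K

end

end AppellSzego

open Filter Topology

namespace AppellSzego

noncomputable section

/-! Put y = 1/x. Up to a Stirling factor tending to 1, f_n(x) is the n-th partial sum of the Taylor
series of 1/g at y, with the k-th term damped by n(n-1)⋯(n-k+1)/n^k (`fnorm_eq_weightedSum`). These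
weights lie in [0,1] and tend to 1, so the sum tends to 1/g(y) inside the disk of convergence
(`tendsto_weightedSum_taylorCoeff`), which settles |x| > 1/r₀. For smaller |x|, the principal parts
of 1/g at its poles in a disk of radius R > 1/|x| are split off (`exists_partial_fractions`), and
only the damped sums of (1 - t/a)^(-(j+1)) remain to be understood.

Such a sum has two regimes, read off from z = ax. If |z| > 1 or |φ(z)| > 1, damping makes it
converge to the value of the pole term, even beyond the disk of convergence (`tendsto_poleSum`). If
|z| < 1 and |φ(z)| < 1, its product with φ(z)^n n^n e^(-n)/n! is asymptotic to n^j (1-z)^j/j!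
(`poleSum_inv_eq`, `tendsto_expPoleRatio`), so it grows like |φ(z)|^(-n) up to powers of n.

Which regime holds where is decided by the submultiplicativity of |φ| on the closed Szegő region
(`norm_phi_mul_le`). It makes the region star-shaped about 0, so its copies for dominant zeros lie
in D₀, and it shows that a non-dominant zero is always outweighed by one of minimal modulus. Hence
off D₀ every pole is in the first regime and f_n(x) → 1/g(1/x) ≠ 0, while in the interior of D_a the
pole at a strictly outweighs all others and f_n(x) φ(ax)^n, divided by a power of √n, has a nonzero
limit (`tendsto_fnorm_mul_phi_pow`).

All limits are taken jointly along `atTop ×ˢ 𝓝 x`; by compactness this gives both the uniformity and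
the absence of zeros. -/

/-! ### Damped Taylor sums inside the disk of convergence. -/

/-- The weight `n (n - 1) ⋯ (n - k + 1) / n ^ k`. -/
def fallWeight (n k : ℕ) : ℝ := (n.descFactorial k : ℝ) / (n : ℝ) ^ k

lemma fallWeight_nonneg (n k : ℕ) : 0 ≤ fallWeight n k := by
  unfold fallWeight; positivity

lemma fallWeight_le_one (n k : ℕ) : fallWeight n k ≤ 1 := by
  unfold fallWeight
  apply div_le_one_of_le₀ _ (by positivity)
  exact_mod_cast Nat.descFactorial_le_pow n k

lemma norm_fallWeight_le_one (n k : ℕ) : ‖(fallWeight n k : ℂ)‖ ≤ 1 := by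
  rw [Complex.norm_real, Real.norm_of_nonneg (fallWeight_nonneg n k)]
  exact fallWeight_le_one n k

lemma fallWeight_of_lt {n k : ℕ} (h : n < k) : fallWeight n k = 0 := by
  simp [fallWeight, Nat.descFactorial_of_lt h]

lemma tendsto_fallWeight (k : ℕ) : Tendsto (fun n => fallWeight n k) atTop (𝓝 1) := by
  induction k with
  | zero => simp [fallWeight]
  | succ k ih =>
    have h1 : Tendsto (fun n : ℕ => 1 - (k : ℝ) / n) atTop (𝓝 (1 - 0)) :=
      tendsto_const_nhds.sub (tendsto_const_div_atTop_nhds_zero_nat _)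
    have h2 := ih.mul h1
    simp only [sub_zero, mul_one] at h2
    refine h2.congr' ?_
    filter_upwards [eventually_ge_atTop (k + 1)] with n hn
    have hn0 : (n : ℝ) ≠ 0 := by norm_cast; omega
    simp only [fallWeight, Nat.descFactorial_succ]
    push_cast [Nat.cast_sub (by omega : k ≤ n)]
    field_simp
    ring

/-- The partial sum of `∑ c_k y ^ k` of order `n` with the weights `fallWeight n k`. -/
def weightedSum (c : ℕ → ℂ) (n : ℕ) (y : ℂ) : ℂ :=
  ∑ k ∈ Finset.range (n + 1), c k * fallWeight n k * y ^ k

/-- The weights vanish for k > n, so the truncation is automatic and dominated convergence for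
series applies. -/
lemma weightedSum_eq_tsum (c : ℕ → ℂ) (n : ℕ) (y : ℂ) :
    weightedSum c n y = ∑' k, c k * fallWeight n k * y ^ k := by
  rw [tsum_eq_sum (s := Finset.range (n + 1))]
  · rfl
  · intro k hk
    rw [fallWeight_of_lt (by rw [Finset.mem_range] at hk; omega)]
    simp

lemma tendsto_fallWeight_prod (k : ℕ) (y : ℂ) :
    Tendsto (fun p : ℕ × ℂ => (fallWeight p.1 k : ℂ)) (atTop ×ˢ 𝓝 y) (𝓝 1) := by
  have := (Complex.continuous_ofReal.tendsto _).comp ((tendsto_fallWeight k).comp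
    (tendsto_fst (f := (atTop : Filter ℕ)) (g := 𝓝 y)))
  simpa [Function.comp_def] using this

/-- The `k`-th Taylor coefficient of `f` at `0`. -/
def taylorCoeff (f : ℂ → ℂ) (k : ℕ) : ℂ := iteratedDeriv k f 0 / (k.factorial : ℂ)

lemma hasSum_taylorCoeff {f : ℂ → ℂ} {R : ℝ} (hf : DifferentiableOn ℂ f (Metric.ball 0 R))
    {t : ℂ} (ht : ‖t‖ < R) : HasSum (fun k => taylorCoeff f k * t ^ k) (f t) := by
  have h := Complex.hasSum_taylorSeries_on_ball hf (by simpa using ht)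
  convert! h using 2 with k
  simp only [taylorCoeff, sub_zero, smul_eq_mul]
  ring

/-- Dominated convergence: for |y| < r < R the terms near y are bounded by |c_k| r^k, because the
weights are at most 1. -/
lemma tendsto_weightedSum_taylorCoeff {f : ℂ → ℂ} {R : ℝ}
    (hf : DifferentiableOn ℂ f (Metric.ball 0 R)) {y : ℂ} (hy : ‖y‖ < R) :
    Tendsto (fun p : ℕ × ℂ => weightedSum (taylorCoeff f) p.1 p.2) (atTop ×ˢ 𝓝 y)
      (𝓝 (f y)) := by
  obtain ⟨r, hyr, hrR⟩ := exists_between hy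
  have hr0 : 0 ≤ r := (norm_nonneg y).trans hyr.le
  have hs : Summable (fun k => ‖taylorCoeff f k * (r : ℂ) ^ k‖) := by
    apply Summable.norm
    exact (hasSum_taylorCoeff hf (by simpa [abs_of_nonneg hr0] using hrR)).summable
  simp_rw [weightedSum_eq_tsum]
  rw [← (hasSum_taylorCoeff hf hy).tsum_eq]
  refine tendsto_tsum_of_dominated_convergence hs ?_ ?_
  · intro k
    have h1 := ((tendsto_fallWeight_prod k y).const_mul (taylorCoeff f k)).mul
      ((tendsto_snd (f := (atTop : Filter ℕ)) (g := 𝓝 y)).pow k)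
    simpa using h1
  · have : ∀ᶠ z in 𝓝 y, ‖z‖ < r := continuous_norm.continuousAt.eventually (gt_mem_nhds hyr)
    filter_upwards [tendsto_snd.eventually this] with p hp k
    rw [norm_mul, norm_mul, norm_mul, norm_pow, norm_pow]
    have h2 : ‖(r : ℂ)‖ = r := by simp [abs_of_nonneg hr0]
    rw [h2]
    have h3 := norm_fallWeight_le_one p.1 k
    have h4 : ‖p.2‖ ^ k ≤ r ^ k := pow_le_pow_left₀ (norm_nonneg _) hp.le k
    calc _ ≤ ‖taylorCoeff f k‖ * 1 * r ^ k := by gcongr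
      _ = _ := by ring

/-! ### Stirling normalization and the local form of the limits. -/

/-- The ratio of Stirling's approximation of `n!` to `n!`. -/
def stirlingRatio (n : ℕ) : ℝ :=
  Real.sqrt (2 * Real.pi * n) * (n : ℝ) ^ n / (n.factorial * Real.exp n)

lemma tendsto_stirlingRatio : Tendsto stirlingRatio atTop (𝓝 1) := by
  have h := Stirling.tendsto_stirlingSeq_sqrt_pi
  have hp : Real.sqrt Real.pi ≠ 0 := by positivity
  have h2 := (tendsto_const_nhds (x := Real.sqrt Real.pi)).div h hp
  rw [div_self hp] at h2
  refine h2.congr' ?_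
  filter_upwards [eventually_ne_atTop 0] with n hn
  have : 0 < (n : ℝ) := by positivity
  simp only [Pi.div_apply, stirlingRatio, Stirling.stirlingSeq]
  have h3 : Real.sqrt (2 * Real.pi * n) = Real.sqrt Real.pi * Real.sqrt (2 * n) := by
    rw [← Real.sqrt_mul (by positivity)]; ring_nf
  rw [h3, div_pow, ← Real.exp_nat_mul, mul_one]
  field_simp

/-- Leibniz's rule for (1/g(t)) · e^(nxt) at t = 0. Dividing n^(n-k)/(n-k)! by n^n/n! leaves exactly
the falling-factorial weight. -/
lemma fnorm_eq_weightedSum {g : ℂ → ℂ} (hg : Differentiable ℂ g) (hg0 : g 0 ≠ 0) {n : ℕ}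
    (hn : n ≠ 0) {x : ℂ} (hx : x ≠ 0) :
    fnorm g n x = stirlingRatio n * weightedSum (taylorCoeff (fun t => 1 / g t)) n x⁻¹ := by
  have hA : AnalyticAt ℂ (fun t => 1 / g t) 0 :=
    analyticAt_const.div (hg.analyticAt 0) hg0
  have hE : AnalyticAt ℂ (fun t => Complex.exp (n * x * t)) 0 := by fun_prop
  have hn' : (n : ℂ) ≠ 0 := by exact_mod_cast hn
  have h1 : appell g n (n * x) = ∑ k ∈ Finset.range (n + 1),
      taylorCoeff (fun t => 1 / g t) k * ((n * x) ^ (n - k) / ((n - k).factorial : ℂ)) := by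
    have : (fun t : ℂ => Complex.exp (n * x * t) / g t) =
        (fun t => 1 / g t) * (fun t => Complex.exp (n * x * t)) := by
      funext t; simp only [Pi.mul_apply]; ring
    rw [appell, this, iteratedDeriv_mul hA.contDiffAt hE.contDiffAt, Finset.sum_div]
    refine Finset.sum_congr rfl fun k hk => ?_
    have hk' : k ≤ n := by simpa [Nat.lt_succ_iff] using hk
    rw [iteratedDeriv_cexp_const_mul, Nat.cast_choose ℂ hk', taylorCoeff]
    have : (n.factorial : ℂ) ≠ 0 := by exact_mod_cast n.factorial_ne_zero
    simp only [mul_zero, Complex.exp_zero, mul_one]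
    field_simp
  rw [fnorm, h1, weightedSum, Finset.mul_sum, Finset.mul_sum, Finset.sum_div]
  refine Finset.sum_congr rfl fun k hk => ?_
  have hk' : k ≤ n := by simpa [Nat.lt_succ_iff] using hk
  have h2 : (n.descFactorial k : ℂ) * ((n - k).factorial : ℂ) = n.factorial := by
    rw [mul_comm]; exact_mod_cast Nat.factorial_mul_descFactorial hk'
  have h3 : (n.factorial : ℂ) ≠ 0 := by exact_mod_cast n.factorial_ne_zero
  have h4 : ((n - k).factorial : ℂ) ≠ 0 := by exact_mod_cast (n - k).factorial_ne_zero
  have h5 : Complex.exp (n : ℂ) = Complex.exp 1 ^ n := by rw [← Complex.exp_nat_mul, mul_one]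
  have h6 : (n : ℂ) ^ n = (n : ℂ) ^ (n - k) * (n : ℂ) ^ k := by rw [← pow_add]; congr 1; omega
  have h7 : x ^ n = x ^ (n - k) * x ^ k := by rw [← pow_add]; congr 1; omega
  have h8 := Complex.exp_ne_zero 1
  have h9 : (fallWeight n k : ℂ) = n.descFactorial k / (n : ℂ) ^ k := by simp [fallWeight]
  have h10 : (stirlingRatio n : ℂ) = (Real.sqrt (2 * Real.pi * n) : ℂ) * (n : ℂ) ^ n /
      (n.factorial * Complex.exp n) := by simp [stirlingRatio]
  rw [h9, h10, h5, ← h2, h6, mul_pow, mul_pow, h7, inv_pow]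
  have h11 : (n.descFactorial k : ℂ) ≠ 0 := by
    intro h; rw [h, zero_mul] at h2; exact h3 h2.symm
  field_simp

/-- A local criterion for `LogLimitOn`. -/
lemma logLimitOn_of_tendsto {f : ℕ → ℂ → ℂ} {L : ℂ → ℝ} {U : Set ℂ}
    (hL : ∀ x ∈ U, ContinuousAt L x)
    (h0 : ∀ x ∈ U, ∀ᶠ p : ℕ × ℂ in atTop ×ˢ 𝓝 x, f p.1 p.2 ≠ 0)
    (hlim : ∀ x ∈ U, Tendsto (fun p : ℕ × ℂ => 1 / (p.1 : ℝ) * Real.log ‖f p.1 p.2‖)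
      (atTop ×ˢ 𝓝 x) (𝓝 (L x))) :
    LogLimitOn f L U := by
  intro K hKU hK
  constructor
  · have : ∀ᶠ p : ℕ × ℂ in atTop ×ˢ 𝓝ˢ K, f p.1 p.2 ≠ 0 := by
      -- For compact K the product with the neighbourhood filter of K is the supremum of the
      -- pointwise products, so the pointwise statements combine into one threshold for n.
      rw [hK.prod_nhdsSet_eq_biSup]
      simp only [eventually_iSup]
      exact fun x hx => h0 x (hKU hx)
    obtain ⟨u, hu, v, hv, huv⟩ := eventually_prod_iff.1 this
    filter_upwards [hu] with n hn x hx
    exact huv hn (hv.self_of_nhdsSet x hx)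
  · rw [← tendstoLocallyUniformlyOn_iff_tendstoUniformlyOn_of_compact hK,
      tendstoLocallyUniformlyOn_iff_forall_tendsto]
    intro x hx
    have h1 : Tendsto (fun p : ℕ × ℂ => L p.2) (atTop ×ˢ 𝓝[K] x) (𝓝 (L x)) :=
      (hL x (hKU hx)).tendsto.comp (tendsto_snd.mono_right nhdsWithin_le_nhds)
    have h2 := (hlim x (hKU hx)).mono_left
      (Filter.prod_mono le_rfl (nhdsWithin_le_nhds (s := K)))
    exact (h1.prodMk_nhds h2).mono_right (nhds_le_uniformity _)

/-! ### The tail of the exponential series. -/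

/-- The weight `n ^ k / ((n + 1) ⋯ (n + k))`. -/
def riseWeight (n k : ℕ) : ℝ := (n : ℝ) ^ k / ((n + 1).ascFactorial k : ℝ)

lemma riseWeight_nonneg (n k : ℕ) : 0 ≤ riseWeight n k := by
  unfold riseWeight; positivity

lemma riseWeight_le_one (n k : ℕ) : riseWeight n k ≤ 1 := by
  unfold riseWeight
  apply div_le_one_of_le₀ _ (by positivity)
  exact_mod_cast (Nat.pow_le_pow_left n.le_succ k).trans (Nat.pow_succ_le_ascFactorial (n + 1) k)

lemma tendsto_riseWeight (k : ℕ) : Tendsto (fun n => riseWeight n k) atTop (𝓝 1) := by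
  induction k with
  | zero => simp [riseWeight]
  | succ k ih =>
    have h1 : Tendsto (fun n : ℕ => 1 + ((1 + k : ℝ)) / n) atTop (𝓝 (1 + 0)) :=
      tendsto_const_nhds.add (tendsto_const_div_atTop_nhds_zero_nat _)
    have h2 := ih.mul (h1.inv₀ (by norm_num))
    simp only [add_zero, inv_one, mul_one] at h2
    refine h2.congr' ?_
    filter_upwards [eventually_ne_atTop 0] with n hn
    have hn0 : (n : ℝ) ≠ 0 := by exact_mod_cast hn
    have h3 : ((n + 1).ascFactorial k : ℝ) ≠ 0 := by
      exact_mod_cast (Nat.ascFactorial_pos n k).ne'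
    have h4 : (n : ℝ) + 1 + k ≠ 0 := by positivity
    have h5 : (n : ℝ) + (1 + k) ≠ 0 := by positivity
    simp only [riseWeight, Nat.ascFactorial_succ]
    push_cast
    field_simp
    ring

/-- The tail `∑_{m > n} (n z) ^ m / m!` of the exponential series, divided by `(n z) ^ n / n!`. -/
def expTail (n : ℕ) (z : ℂ) : ℂ := ∑' k, (riseWeight n (k + 1) : ℂ) * z ^ (k + 1)

lemma tendsto_expTail {z : ℂ} (hz : ‖z‖ < 1) :
    Tendsto (fun p : ℕ × ℂ => expTail p.1 p.2) (atTop ×ˢ 𝓝 z) (𝓝 (z / (1 - z))) := by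
  obtain ⟨r, hzr, hr1⟩ := exists_between hz
  have hr0 : 0 ≤ r := (norm_nonneg z).trans hzr.le
  have h0 : z / (1 - z) = ∑' k : ℕ, z ^ (k + 1) := by
    simp_rw [pow_succ]
    rw [tsum_mul_right, tsum_geometric_of_norm_lt_one hz]
    ring
  rw [h0]
  have hs : Summable fun k : ℕ => r ^ (k + 1) :=
    (summable_nat_add_iff 1).2 (summable_geometric_of_lt_one hr0 hr1)
  refine tendsto_tsum_of_dominated_convergence hs ?_ ?_
  · intro k
    have h1 : Tendsto (fun p : ℕ × ℂ => (riseWeight p.1 (k + 1) : ℂ)) (atTop ×ˢ 𝓝 z) (𝓝 1) := by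
      have := (Complex.continuous_ofReal.tendsto _).comp ((tendsto_riseWeight (k + 1)).comp
        (tendsto_fst (f := (atTop : Filter ℕ)) (g := 𝓝 z)))
      simpa [Function.comp_def] using this
    simpa using h1.mul ((tendsto_snd (f := (atTop : Filter ℕ)) (g := 𝓝 z)).pow (k + 1))
  · have : ∀ᶠ w in 𝓝 z, ‖w‖ < r := continuous_norm.continuousAt.eventually (gt_mem_nhds hzr)
    filter_upwards [tendsto_snd.eventually this] with p hp k
    rw [norm_mul, norm_pow, Complex.norm_real, Real.norm_of_nonneg (riseWeight_nonneg _ _)]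
    calc _ ≤ 1 * r ^ (k + 1) := by
          gcongr
          exact riseWeight_le_one _ _
      _ = _ := one_mul _

/-! ### Pole sums as truncated exponential sums. -/

/-- The weighted sum of the Taylor coefficients of `(1 - t)⁻¹ ^ (j + 1)`. -/
def poleSum (j n : ℕ) (y : ℂ) : ℂ := weightedSum (fun k => ((k + j).choose j : ℂ)) n y

/-- The coefficient of `t ^ n` in `exp (w t) / (1 - t) ^ (j + 1)`. -/
def expPoleCoeff (j n : ℕ) (w : ℂ) : ℂ :=
  ∑ m ∈ Finset.range (n + 1), ((n - m + j).choose j : ℂ) * (w ^ m / (m.factorial : ℂ))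

/-- `n ^ n e ^ (-n) / n!`. -/
def stirlingFactor (n : ℕ) : ℝ := (n : ℝ) ^ n * Real.exp (-n) / n.factorial

lemma stirlingFactor_pos (n : ℕ) : 0 < stirlingFactor n := by
  unfold stirlingFactor
  rcases eq_or_ne n 0 with rfl | h
  · simp
  · have : 0 < (n : ℝ) := by positivity
    positivity

lemma stirlingFactor_le_one (n : ℕ) : stirlingFactor n ≤ 1 := by
  unfold stirlingFactor
  have h := Real.pow_div_factorial_le_exp (n : ℝ) (by positivity) n
  rw [mul_div_right_comm, Real.exp_neg]
  exact mul_inv_le_one_of_le₀ h (by positivity)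

lemma stirlingRatio_eq (n : ℕ) :
    stirlingRatio n = Real.sqrt (2 * Real.pi * n) * stirlingFactor n := by
  rw [stirlingRatio, stirlingFactor, Real.exp_neg]
  have : (n.factorial : ℝ) ≠ 0 := by positivity
  field_simp

lemma phi_pow (n : ℕ) (z : ℂ) :
    phi z ^ n = z ^ n * Complex.exp n * Complex.exp (-(n * z)) := by
  rw [phi, mul_pow, ← Complex.exp_nat_mul, mul_assoc, ← Complex.exp_add]
  ring_nf

lemma phi_ne_zero {z : ℂ} (hz : z ≠ 0) : phi z ≠ 0 := mul_ne_zero hz (Complex.exp_ne_zero _)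

lemma continuous_phi : Continuous phi := by unfold phi; fun_prop

/-- Reversing the summation, k ↦ n - k, turns the powers of 1/z into the terms (nz)^m/m! of the
exponential series. Both regimes of a pole are read off from this identity. -/
lemma poleSum_inv_eq (j : ℕ) {n : ℕ} (hn : n ≠ 0) {z : ℂ} (hz : z ≠ 0) :
    (stirlingFactor n : ℂ) * phi z ^ n * poleSum j n z⁻¹ =
      Complex.exp (-(n * z)) * expPoleCoeff j n (n * z) := by
  have hn' : (n : ℂ) ≠ 0 := by exact_mod_cast hn
  rw [phi_pow, expPoleCoeff, ← Finset.sum_range_reflect, poleSum, weightedSum, Finset.mul_sum,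
    Finset.mul_sum]
  refine Finset.sum_congr rfl fun k hk => ?_
  have hk' : k ≤ n := by simpa [Nat.lt_succ_iff] using hk
  have h1 : n + 1 - 1 - k = n - k := by omega
  have h2 : n - (n - k) = k := by omega
  have h3 : (n.descFactorial k : ℂ) * ((n - k).factorial : ℂ) = n.factorial := by
    rw [mul_comm]; exact_mod_cast Nat.factorial_mul_descFactorial hk'
  have h4 : ((n - k).factorial : ℂ) ≠ 0 := by exact_mod_cast (n - k).factorial_ne_zero
  have h5 : (n : ℂ) ^ n = (n : ℂ) ^ (n - k) * (n : ℂ) ^ k := by rw [← pow_add]; congr 1; omega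
  have h6 : z ^ n = z ^ (n - k) * z ^ k := by rw [← pow_add]; congr 1; omega
  have h7 : (stirlingFactor n : ℂ) = (n : ℂ) ^ n * Complex.exp (-n) / n.factorial := by
    simp [stirlingFactor]
  have h8 : (fallWeight n k : ℂ) = n.descFactorial k / (n : ℂ) ^ k := by simp [fallWeight]
  have h9 : (n.descFactorial k : ℂ) ≠ 0 := by
    intro h
    rw [h, zero_mul] at h3
    exact n.factorial_ne_zero (by exact_mod_cast h3.symm)
  have h10 := Complex.exp_ne_zero (n : ℂ)
  rw [h1, h2, h7, h8, ← h3, h5, h6, inv_pow, mul_pow, Complex.exp_neg (n : ℂ)]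
  field_simp

/-- For j = 0 the sum is the exponential series of nz cut after the n-th term, hence e^(nz) minus
its tail. -/
lemma exp_mul_expPoleCoeff_zero (n : ℕ) (z : ℂ) :
    Complex.exp (-(n * z)) * expPoleCoeff 0 n (n * z) =
      1 - stirlingFactor n * phi z ^ n * expTail n z := by
  have h := NormedSpace.expSeries_div_hasSum_exp ((n : ℂ) * z)
  rw [← Complex.exp_eq_exp_ℂ] at h
  have h1 : expPoleCoeff 0 n (n * z) + ∑' k, ((n : ℂ) * z) ^ (k + (n + 1)) /
      ((k + (n + 1)).factorial : ℂ) = Complex.exp (n * z) := by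
    rw [← h.tsum_eq, ← h.summable.sum_add_tsum_nat_add (n + 1)]
    simp [expPoleCoeff]
  have h2 : ∑' k, ((n : ℂ) * z) ^ (k + (n + 1)) / ((k + (n + 1)).factorial : ℂ) =
      (n : ℂ) ^ n * z ^ n / n.factorial * expTail n z := by
    rw [expTail, ← tsum_mul_left]
    refine tsum_congr fun k => ?_
    have h3 : ((k + (n + 1)).factorial : ℂ) = n.factorial * ((n + 1).ascFactorial (k + 1)) := by
      have := Nat.factorial_mul_ascFactorial n (k + 1)
      rw [show k + (n + 1) = n + (k + 1) by ring, ← this]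
      push_cast; rfl
    have h4 : (n.factorial : ℂ) ≠ 0 := by exact_mod_cast n.factorial_ne_zero
    have h5 : ((n + 1).ascFactorial (k + 1) : ℂ) ≠ 0 := by
      exact_mod_cast (Nat.ascFactorial_pos n (k + 1)).ne'
    rw [h3, mul_pow]
    simp only [riseWeight]
    push_cast
    field_simp
    ring
  have h7 : (stirlingFactor n : ℂ) = (n : ℂ) ^ n * Complex.exp (-n) / n.factorial := by
    simp [stirlingFactor]
  rw [h2] at h1
  rw [eq_sub_of_add_eq h1, mul_sub, ← Complex.exp_add, neg_add_cancel, Complex.exp_zero, phi_pow,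
    h7, Complex.exp_neg (n : ℂ)]
  have h10 := Complex.exp_ne_zero (n : ℂ)
  field_simp

lemma taylorCoeff_eq_of_hasSum {f : ℂ → ℂ} {c : ℕ → ℂ} {r : ℝ} (hr : 0 < r)
    (h : ∀ t : ℂ, ‖t‖ < r → HasSum (fun k => c k * t ^ k) (f t)) (k : ℕ) :
    taylorCoeff f k = c k := by
  have h1 : HasFPowerSeriesAt f (FormalMultilinearSeries.ofScalars ℂ c) 0 := by
    rw [hasFPowerSeriesAt_iff]
    filter_upwards [Metric.ball_mem_nhds (0 : ℂ) hr] with t ht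
    have := h t (by simpa using ht)
    simpa [FormalMultilinearSeries.coeff_ofScalars, mul_comm] using this
  have h2 := h1.eq_formalMultilinearSeries h1.analyticAt.hasFPowerSeriesAt
  have h3 := congrArg (fun p => FormalMultilinearSeries.coeff p k) h2
  simp only [FormalMultilinearSeries.coeff_ofScalars] at h3
  exact h3.symm

lemma taylorCoeff_pole (j : ℕ) {a : ℂ} (ha : a ≠ 0) (k : ℕ) :
    taylorCoeff (fun t => 1 / (1 - t / a) ^ (j + 1)) k = ((k + j).choose j : ℂ) * a⁻¹ ^ k := by
  refine taylorCoeff_eq_of_hasSum (c := fun k => ((k + j).choose j : ℂ) * a⁻¹ ^ k)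
    (norm_pos_iff.2 ha) (fun t ht => ?_) k
  have h1 : ‖t / a‖ < 1 := by rw [norm_div]; exact (div_lt_one (norm_pos_iff.2 ha)).2 ht
  have h2 := hasSum_choose_mul_geometric_of_norm_lt_one j h1
  convert! h2 using 2 with k
  rw [div_eq_mul_inv, mul_pow]
  ring

lemma taylorCoeff_pole_one (j k : ℕ) :
    taylorCoeff (fun t => 1 / (1 - t) ^ (j + 1)) k = ((k + j).choose j : ℂ) := by
  simpa using taylorCoeff_pole j one_ne_zero k

lemma tendsto_poleSum_of_norm_lt_one (j : ℕ) {y : ℂ} (hy : ‖y‖ < 1) :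
    Tendsto (fun p : ℕ × ℂ => poleSum j p.1 p.2) (atTop ×ˢ 𝓝 y)
      (𝓝 (1 / (1 - y) ^ (j + 1))) := by
  have hd : DifferentiableOn ℂ (fun t : ℂ => 1 / (1 - t) ^ (j + 1)) (Metric.ball 0 1) := by
    intro t ht
    have h1 : (1 - t) ^ (j + 1) ≠ 0 := by
      apply pow_ne_zero
      intro h
      rw [sub_eq_zero] at h
      simp [← h] at ht
    apply DifferentiableAt.differentiableWithinAt
    fun_prop (disch := assumption)
  have := tendsto_weightedSum_taylorCoeff hd hy
  simpa only [poleSum, ← funext (taylorCoeff_pole_one j)] using this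

/-! ### The saddle point regime for simple poles. -/

lemma integrableOn_exp_neg_mul_pow (k : ℕ) :
    MeasureTheory.IntegrableOn (fun s : ℝ => Complex.exp (-s) * (s : ℂ) ^ k) (Set.Ioi 0) := by
  have h := (Real.GammaIntegral_convergent (s := k + 1) (by positivity)).ofReal (𝕜 := ℂ)
  refine MeasureTheory.IntegrableOn.congr_fun h (fun s _ => ?_) measurableSet_Ioi
  simp

lemma integral_exp_neg_mul_pow (k : ℕ) :
    ∫ s in Set.Ioi (0 : ℝ), Complex.exp (-s) * (s : ℂ) ^ k = (k.factorial : ℂ) := by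
  have h := Real.Gamma_eq_integral (s := k + 1) (by positivity)
  rw [Real.Gamma_nat_eq_factorial] at h
  have h2 := congrArg (fun x : ℝ => (x : ℂ)) h
  simp only [add_sub_cancel_right, Real.rpow_natCast] at h2
  rw [← integral_complex_ofReal] at h2
  simpa using h2.symm

/-- The falling factorial is k! times a binomial coefficient; replacing k! by Euler's integral lets
the binomial theorem sum the series. This serves the circle |y| = 1, which the power series and the
exponential tail do not reach. -/
lemma poleSum_zero_eq_integral {n : ℕ} (y : ℂ) :
    poleSum 0 n y = ∫ s in Set.Ioi (0 : ℝ), Complex.exp (-s) * (1 + s * y / n) ^ n := by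
  have h1 : ∀ s : ℝ, Complex.exp (-s) * (1 + s * y / n) ^ n = ∑ k ∈ Finset.range (n + 1),
      ((n.choose k : ℂ) * (y / n) ^ k) * (Complex.exp (-s) * (s : ℂ) ^ k) := by
    intro s
    rw [add_comm, add_pow, Finset.mul_sum]
    refine Finset.sum_congr rfl fun k _ => ?_
    rw [one_pow, mul_div_assoc, mul_pow]
    ring
  simp_rw [h1]
  rw [MeasureTheory.integral_finsetSum]
  · rw [poleSum, weightedSum]
    refine Finset.sum_congr rfl fun k _ => ?_
    rw [MeasureTheory.integral_const_mul, integral_exp_neg_mul_pow]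
    simp only [fallWeight, Nat.descFactorial_eq_factorial_mul_choose]
    push_cast
    simp
    ring
  · intro k _
    exact (integrableOn_exp_neg_mul_pow k).const_mul _

lemma tendsto_one_add_div_pow {ι : Type*} {l : Filter ι} {N : ι → ℕ} {u : ι → ℂ} {w : ℂ}
    (hN : Tendsto N l atTop) (hu : Tendsto u l (𝓝 w)) :
    Tendsto (fun i => (1 + u i / N i) ^ N i) l (𝓝 (Complex.exp w)) := by
  have hN' : Tendsto (fun i => ((N i : ℂ))⁻¹) l (𝓝 0) :=
    (tendsto_inv_atTop_nhds_zero_nat (𝕜 := ℂ)).comp hN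
  have h0 : Tendsto (fun i => u i / N i) l (𝓝 0) := by
    simpa [div_eq_mul_inv] using hu.mul hN'
  have hlog : (fun t : ℂ => Complex.log (1 + t) - t) =o[𝓝 0] fun t => t := by
    have h1 : HasDerivAt (fun t : ℂ => Complex.log (1 + t)) 1 0 := by
      have := ((hasDerivAt_id (0 : ℂ)).const_add 1).clog (by simp)
      simpa using this
    simpa using h1.isLittleO
  have h1 : Tendsto (fun i => (N i : ℂ) * Complex.log (1 + u i / N i)) l (𝓝 w) := by
    have h2 : (fun i => (N i : ℂ) * (Complex.log (1 + u i / N i) - u i / N i)) =o[l]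
        fun i => (N i : ℂ) * (u i / N i) :=
      (Asymptotics.isBigO_refl (fun i => (N i : ℂ)) l).mul_isLittleO (hlog.comp_tendsto h0)
    have h3 : Tendsto (fun i => (N i : ℂ) * (u i / N i)) l (𝓝 w) := by
      refine hu.congr' ?_
      filter_upwards [hN.eventually (eventually_ne_atTop 0)] with i hi
      have : (N i : ℂ) ≠ 0 := by exact_mod_cast hi
      field_simp
    have h4 : Tendsto (fun i => (N i : ℂ) * (Complex.log (1 + u i / N i) - u i / N i)) l (𝓝 0) :=
      (Asymptotics.isLittleO_one_iff ℂ).1 (h2.trans_isBigO (h3.isBigO_one ℂ))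
    have := h4.add h3
    simp only [zero_add] at this
    refine this.congr fun i => ?_
    ring
  refine ((Complex.continuous_exp.tendsto w).comp h1).congr' ?_
  have h5 : ∀ᶠ i in l, 1 + u i / N i ≠ 0 := by
    have : Tendsto (fun i => 1 + u i / N i) l (𝓝 (1 + 0)) := tendsto_const_nhds.add h0
    exact this.eventually_ne (by norm_num)
  filter_upwards [h5] with i hi
  rw [Function.comp_apply, Complex.exp_nat_mul, Complex.exp_log hi]

/-- The integrand tends to e^(-s(1-y)), integrable since Re y < 1, and dominated convergence
applies. -/
lemma tendsto_poleSum_zero_of_norm_eq_one {y : ℂ} (hy : ‖y‖ = 1) (hy1 : y ≠ 1) :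
    Tendsto (fun p : ℕ × ℂ => poleSum 0 p.1 p.2) (atTop ×ˢ 𝓝 y) (𝓝 (1 / (1 - y))) := by
  have hre : y.re < 1 := by
    rcases (Complex.re_le_norm y).lt_or_eq with h | h
    · rwa [hy] at h
    · exfalso
      have h1 : y.re = 1 := h.trans hy
      have h2 := Complex.sq_norm y
      rw [Complex.normSq_apply, hy, h1] at h2
      exact hy1 (Complex.ext h1 (by simpa using h2))
  have hre' : -1 ≤ y.re := by
    have := Complex.abs_re_le_norm y
    rw [hy] at this
    exact (abs_le.1 this).1
  -- Since Re y ≥ -1, c ≤ 1/4, so 2(1-c)² > 1 = |y|²; also Re y < 1-c. Near y this gives |1+vw|² ≤ 1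
  -- + 2v(1-c) + 2v²(1-c)² ≤ e^(2v(1-c)) for v ≥ 0, hence the majorant e^(-cs).
  set c := (1 - y.re) / 8 with hc
  have hc0 : 0 < c := by linarith
  have hI : 1 / (1 - y) = ∫ s in Set.Ioi (0 : ℝ), Complex.exp (-s) * Complex.exp (s * y) := by
    have h := integral_exp_mul_complex_Ioi (a := y - 1) (by simpa using hre) 0
    have h2 : 1 - y ≠ 0 := sub_ne_zero.2 hy1.symm
    have h3 : y - 1 ≠ 0 := sub_ne_zero.2 hy1
    calc 1 / (1 - y) = - Complex.exp ((y - 1) * (0 : ℝ)) / (y - 1) := by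
          simp only [Complex.ofReal_zero, mul_zero, Complex.exp_zero]
          rw [neg_div, ← div_neg, neg_sub]
      _ = _ := by
          rw [← h]
          refine MeasureTheory.integral_congr_ae (MeasureTheory.ae_of_all _ fun s => ?_)
          simp only
          rw [← Complex.exp_add]
          ring_nf
  rw [hI]
  simp_rw [poleSum_zero_eq_integral]
  refine MeasureTheory.tendsto_integral_filter_of_dominated_convergence
    (fun s => Real.exp (-c * s)) ?_ ?_ ?_ ?_
  · refine Eventually.of_forall fun p => Continuous.aestronglyMeasurable ?_
    fun_prop
  · have e1 : ∀ᶠ w : ℂ in 𝓝 y, w.re < 1 - c :=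
      Complex.continuous_re.continuousAt.eventually (gt_mem_nhds (by linarith))
    have e2 : ∀ᶠ w : ℂ in 𝓝 y, ‖w‖ ^ 2 < 2 * (1 - c) ^ 2 := by
      refine (continuous_norm.pow 2).continuousAt.eventually (gt_mem_nhds ?_)
      simp only [Pi.pow_apply, hy]
      nlinarith
    filter_upwards [tendsto_snd.eventually (e1.and e2),
      tendsto_fst.eventually (eventually_ne_atTop 0)] with p hp hn
    refine (MeasureTheory.ae_restrict_iff' measurableSet_Ioi).2 (MeasureTheory.ae_of_all _ fun s hs => ?_)
    have hs0 : 0 < s := hs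
    have hn0 : (0 : ℝ) < p.1 := by positivity
    set v := s / p.1 with hv
    have hv0 : 0 < v := by positivity
    have h1 : ‖1 + s * p.2 / p.1‖ ^ 2 ≤ Real.exp (v * (1 - c)) ^ 2 := by
      have h2 : (1 : ℂ) + s * p.2 / p.1 = 1 + (v : ℝ) * p.2 := by
        rw [hv]; push_cast; ring
      rw [h2, Complex.sq_norm, Complex.normSq_apply, ← Real.exp_nat_mul]
      have h3 := Real.quadratic_le_exp_of_nonneg (x := (2 : ℕ) * (v * (1 - c)))
        (by have : c ≤ 1 / 4 := by linarith
            have : 0 ≤ 1 - c := by linarith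
            positivity)
      refine le_trans ?_ h3
      have h4 : ‖p.2‖ ^ 2 = p.2.re * p.2.re + p.2.im * p.2.im := by
        rw [Complex.sq_norm, Complex.normSq_apply]
      have h5 := hp.2.le
      rw [h4] at h5
      have h6 := mul_le_mul_of_nonneg_left h5 (sq_nonneg v)
      have h7 := mul_le_mul_of_nonneg_left hp.1.le hv0.le
      simp only [Complex.add_re, Complex.one_re, Complex.mul_re, Complex.ofReal_re,
        Complex.ofReal_im, Complex.add_im, Complex.one_im, Complex.mul_im, zero_mul, sub_zero,
        zero_add, add_zero]
      push_cast
      nlinarith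
    have h8 : ‖1 + s * p.2 / p.1‖ ≤ Real.exp (v * (1 - c)) :=
      le_of_sq_le_sq h1 (Real.exp_pos _).le
    rw [norm_mul, norm_pow, Complex.norm_exp]
    calc _ ≤ Real.exp (-s) * Real.exp (v * (1 - c)) ^ p.1 := by
          gcongr
          simp
      _ = Real.exp (-c * s) := by
          rw [← Real.exp_nat_mul, ← Real.exp_add]
          congr 1
          rw [hv]
          field_simp
          ring
  · exact integrableOn_exp_mul_Ioi (by linarith) 0
  · refine MeasureTheory.ae_of_all _ fun s => ?_
    refine Tendsto.const_mul _ ?_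
    exact tendsto_one_add_div_pow (u := fun p : ℕ × ℂ => s * p.2) tendsto_fst
      (tendsto_snd.const_mul _)

lemma tendsto_pow_mul_pow_prod (N : ℕ) {f : ℂ → ℝ} {x : ℂ} (hf : ContinuousAt f x)
    (h0 : ∀ z, 0 ≤ f z) (h1 : f x < 1) :
    Tendsto (fun p : ℕ × ℂ => (p.1 : ℝ) ^ N * f p.2 ^ p.1) (atTop ×ˢ 𝓝 x) (𝓝 0) := by
  obtain ⟨r, hxr, hr1⟩ := exists_between h1
  have hr0 : 0 ≤ r := (h0 x).trans hxr.le
  have h2 := (tendsto_pow_const_mul_const_pow_of_lt_one N hr0 hr1).comp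
    (tendsto_fst (f := (atTop : Filter ℕ)) (g := 𝓝 x))
  refine squeeze_zero' (Eventually.of_forall fun p => ?_) ?_ h2
  · have := h0 p.2; positivity
  · filter_upwards [tendsto_snd.eventually (hf.eventually (gt_mem_nhds hxr))] with p hp
    exact mul_le_mul_of_nonneg_left (pow_le_pow_left₀ (h0 _) hp.le _) (by positivity)

/-- With z = 1/y, the exponential-tail identity solved for the pole sum has two terms. One is the
inverse of φ(z)^n n^n e^(-n)/n!, which vanishes because |φ(z)|^n beats the √n of Stirling's formula;
the other is minus the tail, with limit -z/(1-z) = 1/(1-y). -/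
lemma tendsto_poleSum_zero_of_one_lt_norm {y : ℂ} (hy : 1 < ‖y‖) (hphi : 1 < ‖phi y⁻¹‖) :
    Tendsto (fun p : ℕ × ℂ => poleSum 0 p.1 p.2) (atTop ×ˢ 𝓝 y) (𝓝 (1 / (1 - y))) := by
  have hy0 : y ≠ 0 := by rintro rfl; simp at hy; linarith
  have hinv : Tendsto (fun p : ℕ × ℂ => (p.1, p.2⁻¹)) (atTop ×ˢ 𝓝 y) (atTop ×ˢ 𝓝 y⁻¹) :=
    tendsto_id.prodMap (tendsto_inv₀ hy0)
  have h1 := (tendsto_expTail (z := y⁻¹)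
    (by rw [norm_inv]; exact inv_lt_one_of_one_lt₀ hy)).comp hinv
  have h2 : y⁻¹ / (1 - y⁻¹) = -(1 / (1 - y)) := by
    have h3 : 1 - y ≠ 0 := by
      intro h; rw [sub_eq_zero] at h; simp [← h] at hy
    have h4 : y - 1 ≠ 0 := by rw [← neg_sub]; exact neg_ne_zero.2 h3
    have h5 : 1 - y⁻¹ = (y - 1) / y := by field_simp
    rw [h5, ← neg_sub y 1]
    field_simp
  rw [h2] at h1
  have h3 : Tendsto (fun p : ℕ × ℂ => ((stirlingFactor p.1 : ℂ) * phi p.2⁻¹ ^ p.1)⁻¹)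
      (atTop ×ˢ 𝓝 y) (𝓝 0) := by
    rw [tendsto_zero_iff_norm_tendsto_zero]
    have h4 := (tendsto_pow_mul_pow_prod 1 (f := fun z => ‖(phi z)⁻¹‖) (x := y⁻¹)
      ((continuous_phi.continuousAt.inv₀ (phi_ne_zero (inv_ne_zero hy0))).norm)
      (fun _ => norm_nonneg _)
      (by rw [norm_inv]; exact inv_lt_one_of_one_lt₀ hphi)).comp hinv
    have h5 := ((tendsto_stirlingRatio.comp (tendsto_fst (f := atTop) (g := 𝓝 y))).inv₀
      one_ne_zero).mul (h4.const_mul (2 * Real.pi))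
    simp only [mul_zero] at h5
    refine squeeze_zero' (Eventually.of_forall fun p => norm_nonneg _) ?_ h5
    filter_upwards [tendsto_fst.eventually (eventually_ne_atTop 0)] with p hn
    have hn1 : (1 : ℝ) ≤ p.1 := by exact_mod_cast Nat.one_le_iff_ne_zero.2 hn
    have hpi : (1 : ℝ) ≤ 2 * Real.pi * p.1 := by nlinarith [Real.pi_gt_three]
    have hs : Real.sqrt (2 * Real.pi * p.1) ≤ 2 * Real.pi * p.1 :=
      Real.sqrt_le_iff.2 ⟨by linarith, by nlinarith⟩
    have hs0 : 0 < Real.sqrt (2 * Real.pi * p.1) := Real.sqrt_pos.2 (by linarith)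
    simp only [Function.comp_apply]
    rw [norm_inv, norm_mul, norm_pow, Complex.norm_real,
      Real.norm_of_nonneg (stirlingFactor_pos _).le, stirlingRatio_eq, mul_inv, mul_inv, norm_inv,
      inv_pow, pow_one]
    have h6 := (stirlingFactor_pos p.1)
    calc (stirlingFactor p.1)⁻¹ * (‖phi p.2⁻¹‖ ^ p.1)⁻¹
        = (Real.sqrt (2 * Real.pi * p.1))⁻¹ * (stirlingFactor p.1)⁻¹ *
          (Real.sqrt (2 * Real.pi * p.1) * (‖phi p.2⁻¹‖ ^ p.1)⁻¹) := by field_simp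
      _ ≤ (Real.sqrt (2 * Real.pi * p.1))⁻¹ * (stirlingFactor p.1)⁻¹ *
          (2 * Real.pi * p.1 * (‖phi p.2⁻¹‖ ^ p.1)⁻¹) := by gcongr
      _ = _ := by ring
  have h6 := h3.sub h1
  simp only [zero_sub, neg_neg] at h6
  refine h6.congr' ?_
  filter_upwards [tendsto_fst.eventually (eventually_ne_atTop 0),
    tendsto_snd.eventually (isOpen_ne.mem_nhds hy0)] with p hn hp
  have h7 := poleSum_inv_eq 0 hn (inv_ne_zero hp)
  rw [exp_mul_expPoleCoeff_zero, inv_inv] at h7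
  have h8 : (stirlingFactor p.1 : ℂ) * phi p.2⁻¹ ^ p.1 ≠ 0 :=
    mul_ne_zero (by exact_mod_cast (stirlingFactor_pos _).ne')
      (pow_ne_zero _ (phi_ne_zero (inv_ne_zero hp)))
  simp only [Function.comp_apply]
  rw [eq_comm, ← mul_right_inj' h8, h7, mul_sub, mul_inv_cancel₀ h8]

/-! ### The saddle point regime for poles of any order. -/

/-- The points `y` at which the saddle point contribution to `poleSum` prevails. -/
def saddleRegion : Set ℂ := {y | ‖y‖ < 1 ∨ (y ≠ 0 ∧ 1 < ‖phi y⁻¹‖)}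

lemma isOpen_saddleRegion : IsOpen saddleRegion := by
  refine (isOpen_lt continuous_norm continuous_const).union ?_
  refine isOpen_iff_mem_nhds.2 fun y hy => ?_
  have h1 : ContinuousAt (fun y : ℂ => ‖phi y⁻¹‖) y :=
    (continuous_phi.continuousAt.comp (continuousAt_inv₀ hy.1)).norm
  filter_upwards [isOpen_ne.mem_nhds hy.1, h1.eventually (lt_mem_nhds hy.2)] with z hz hz'
  exact ⟨hz, hz'⟩

lemma ne_one_of_mem_saddleRegion {y : ℂ} (hy : y ∈ saddleRegion) : y ≠ 1 := by
  rintro rfl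
  simp [saddleRegion, phi] at hy

lemma tendsto_poleSum_zero {y : ℂ} (hy : y ∈ saddleRegion) :
    Tendsto (fun p : ℕ × ℂ => poleSum 0 p.1 p.2) (atTop ×ˢ 𝓝 y) (𝓝 (1 / (1 - y))) := by
  rcases lt_trichotomy ‖y‖ 1 with h | h | h
  · simpa using tendsto_poleSum_of_norm_lt_one 0 h
  · exact tendsto_poleSum_zero_of_norm_eq_one h (ne_one_of_mem_saddleRegion hy)
  · rcases hy with h' | ⟨_, h'⟩
    · exact absurd h' h.not_gt
    · exact tendsto_poleSum_zero_of_one_lt_norm h h'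

lemma hasDerivAt_weightedSum (c : ℕ → ℂ) (n : ℕ) (y : ℂ) :
    HasDerivAt (weightedSum c n)
      (∑ k ∈ Finset.range (n + 1), c k * fallWeight n k * (k * y ^ (k - 1))) y := by
  unfold weightedSum
  exact HasDerivAt.fun_sum fun k _ => (hasDerivAt_pow k y).const_mul _

/-- The binomial coefficients of order j+1 are those of order j times 1 + k/(j+1), and the factor k
is the operator y d/dy. -/
lemma poleSum_succ (j n : ℕ) (y : ℂ) :
    poleSum (j + 1) n y = poleSum j n y + y / (j + 1) * deriv (poleSum j n) y := by
  have h1 : deriv (poleSum j n) y = _ := (hasDerivAt_weightedSum _ n y).deriv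
  rw [h1, poleSum, poleSum, weightedSum, weightedSum, Finset.mul_sum, ← Finset.sum_add_distrib]
  refine Finset.sum_congr rfl fun k _ => ?_
  have h2 : ((k + (j + 1)).choose (j + 1) : ℂ) * (j + 1) = (k + j).choose j * (k + j + 1) := by
    have := Nat.add_one_mul_choose_eq (k + j) j
    rw [mul_comm] at this
    exact_mod_cast this.symm
  have h3 : (j : ℂ) + 1 ≠ 0 := by exact_mod_cast j.succ_ne_zero
  have h4 : y * (k * y ^ (k - 1)) = k * y ^ k := by
    rcases k with _ | k
    · simp
    · simp only [Nat.add_sub_cancel, pow_succ]; ring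
  rw [eq_div_of_mul_eq h3 h2]
  calc _ = (k + j).choose j * fallWeight n k * y ^ k +
        1 / (j + 1) * ((k + j).choose j * fallWeight n k * (k * y ^ k)) := by field_simp; ring
    _ = _ := by rw [← h4]; ring

lemma tendstoLocallyUniformlyOn_iff_tendsto {f : ℕ → ℂ → ℂ} {L : ℂ → ℂ} {U : Set ℂ}
    (hU : IsOpen U) (hL : ContinuousOn L U) :
    TendstoLocallyUniformlyOn f L atTop U ↔
      ∀ y ∈ U, Tendsto (fun p : ℕ × ℂ => f p.1 p.2) (atTop ×ˢ 𝓝 y) (𝓝 (L y)) := by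
  rw [hU.tendstoLocallyUniformlyOn_iff_forall_tendsto]
  refine forall₂_congr fun y hy => ?_
  have h1 : Tendsto (fun p : ℕ × ℂ => L p.2) (atTop ×ˢ 𝓝 y) (𝓝 (L y)) :=
    (hL.continuousAt (hU.mem_nhds hy)).tendsto.comp tendsto_snd
  constructor
  · intro h
    exact (Uniform.tendsto_congr (by simpa using! h)).1 h1
  · intro h
    exact (h1.prodMk_nhds h).mono_right (nhds_le_uniformity _)

lemma differentiableOn_pole (j : ℕ) :
    DifferentiableOn ℂ (fun y : ℂ => 1 / (1 - y) ^ (j + 1)) saddleRegion := by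
  intro y hy
  have h1 : (1 - y) ^ (j + 1) ≠ 0 :=
    pow_ne_zero _ (sub_ne_zero.2 (ne_one_of_mem_saddleRegion hy).symm)
  apply DifferentiableAt.differentiableWithinAt
  fun_prop (disch := assumption)

/-- Locally uniform limits of holomorphic functions may be differentiated, so the case j = 0
propagates to all j. This needs an open set, hence the separate treatment of the unit circle for j =
0. -/
lemma tendsto_poleSum (j : ℕ) {y : ℂ} (hy : y ∈ saddleRegion) :
    Tendsto (fun p : ℕ × ℂ => poleSum j p.1 p.2) (atTop ×ˢ 𝓝 y)
      (𝓝 (1 / (1 - y) ^ (j + 1))) := by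
  induction j generalizing y with
  | zero => simpa using tendsto_poleSum_zero hy
  | succ j ih =>
    have hd := (differentiableOn_pole j)
    have h1 := (tendstoLocallyUniformlyOn_iff_tendsto isOpen_saddleRegion hd.continuousOn).2
      (fun y hy => ih hy)
    have h2 := h1.deriv (Eventually.of_forall fun n z _ =>
      (hasDerivAt_weightedSum _ n z).differentiableAt.differentiableWithinAt) isOpen_saddleRegion
    have h3 := (tendstoLocallyUniformlyOn_iff_tendsto isOpen_saddleRegion
      (hd.deriv isOpen_saddleRegion).continuousOn).1 h2 y hy
    have h4 := (ih hy).add (((tendsto_snd (f := (atTop : Filter ℕ)) (g := 𝓝 y)).div_const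
      ((j : ℂ) + 1)).mul h3)
    have hy1 : 1 - y ≠ 0 := sub_ne_zero.2 (ne_one_of_mem_saddleRegion hy).symm
    have h5 : deriv (fun y : ℂ => 1 / (1 - y) ^ (j + 1)) y = (j + 1) / (1 - y) ^ (j + 2) := by
      have h6 : HasDerivAt (fun y : ℂ => ((1 - y) ^ (j + 1))⁻¹) _ y :=
        (((hasDerivAt_id y).const_sub 1).fun_pow (j + 1)).fun_inv (pow_ne_zero _ hy1)
      simp only [one_div]
      rw [h6.deriv]
      simp only [id, Nat.add_sub_cancel]
      push_cast
      field_simp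
      ring
    rw [h5] at h4
    have h6 : (j : ℂ) + 1 ≠ 0 := by exact_mod_cast j.succ_ne_zero
    have h7 : 1 / (1 - y) ^ (j + 1) + y / ((j : ℂ) + 1) * ((j + 1) / (1 - y) ^ (j + 2)) =
        1 / (1 - y) ^ (j + 1 + 1) := by
      field_simp
      ring
    rw [h7] at h4
    exact h4.congr fun p => (poleSum_succ j p.1 p.2).symm

/-! ### Recurrences in the pole order and the exponentially growing regime. -/

lemma sum_mul_pow_div_factorial (c : ℕ → ℂ) (n : ℕ) (w : ℂ) :
    ∑ m ∈ Finset.range (n + 1), m * c m * (w ^ m / (m.factorial : ℂ)) =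
      w * ∑ m ∈ Finset.range n, c (m + 1) * (w ^ m / (m.factorial : ℂ)) := by
  rw [Finset.sum_range_succ', Finset.mul_sum]
  simp only [Nat.cast_zero, zero_mul, add_zero]
  refine Finset.sum_congr rfl fun m _ => ?_
  have h1 : (m.factorial : ℂ) ≠ 0 := by exact_mod_cast m.factorial_ne_zero
  have h2 : (m : ℂ) + 1 ≠ 0 := by exact_mod_cast m.succ_ne_zero
  rw [Nat.factorial_succ]
  push_cast
  field_simp
  ring

lemma expPoleCoeff_succ_eq (j n : ℕ) (w : ℂ) :
    (j + 1) * expPoleCoeff (j + 1) n w = (n + j + 1) * expPoleCoeff j n w -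
      ∑ m ∈ Finset.range (n + 1), m * ((n - m + j).choose j : ℂ) *
        (w ^ m / (m.factorial : ℂ)) := by
  rw [expPoleCoeff, expPoleCoeff, Finset.mul_sum, Finset.mul_sum, ← Finset.sum_sub_distrib]
  refine Finset.sum_congr rfl fun m hm => ?_
  have hm' : m ≤ n := by simpa [Nat.lt_succ_iff] using hm
  have h1 : ((n - m + j + 1 : ℕ) : ℂ) * ((n - m + j).choose j : ℂ) =
      ((n - m + (j + 1)).choose (j + 1) : ℂ) * (j + 1) := by
    exact_mod_cast Nat.add_one_mul_choose_eq (n - m + j) j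
  push_cast [Nat.cast_sub hm'] at h1
  rw [← mul_assoc, mul_comm ((j : ℂ) + 1), ← h1]
  ring

lemma expPoleCoeff_one (n : ℕ) (w : ℂ) :
    expPoleCoeff 1 n w =
      (n + 1 - w) * expPoleCoeff 0 n w + w * (w ^ n / (n.factorial : ℂ)) := by
  have h := expPoleCoeff_succ_eq 0 n w
  rw [sum_mul_pow_div_factorial (fun m => ((n - m + 0).choose 0 : ℂ))] at h
  have h2 : expPoleCoeff 0 n w = ∑ m ∈ Finset.range n, (w ^ m / (m.factorial : ℂ)) +
      w ^ n / (n.factorial : ℂ) := by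
    simp [expPoleCoeff, Finset.sum_range_succ]
  simp only [Nat.choose_zero_right, Nat.cast_one, one_mul, Nat.cast_zero, zero_add,
    add_zero] at h
  rw [h]
  linear_combination w * h2

/-- By Pascal's rule the shifted sum left over by the absorption identity is the difference of the
sums of orders j+1 and j. The resulting three-term recurrence carries asymptotics from j = 0, 1
upwards. -/
lemma expPoleCoeff_add_two (j n : ℕ) (w : ℂ) :
    (j + 2) * expPoleCoeff (j + 2) n w =
      (n + j + 2 - w) * expPoleCoeff (j + 1) n w + w * expPoleCoeff j n w := by
  have h := expPoleCoeff_succ_eq (j + 1) n w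
  rw [sum_mul_pow_div_factorial (fun m => ((n - m + (j + 1)).choose (j + 1) : ℂ))] at h
  have h2 : expPoleCoeff (j + 1) n w = expPoleCoeff j n w + ∑ m ∈ Finset.range n,
      ((n - (m + 1) + (j + 1)).choose (j + 1) : ℂ) * (w ^ m / (m.factorial : ℂ)) := by
    rw [expPoleCoeff, expPoleCoeff, Finset.sum_range_succ, Finset.sum_range_succ _ n,
      add_right_comm, ← Finset.sum_add_distrib]
    congr 1
    · refine Finset.sum_congr rfl fun m hm => ?_
      have hm' : m < n := by simpa using hm
      have h3 : n - m + (j + 1) = (n - (m + 1) + (j + 1)) + 1 := by omega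
      have h4 : n - m + j = n - (m + 1) + (j + 1) := by omega
      rw [h3, Nat.choose_succ_succ, h4]
      push_cast
      ring
    · simp
  push_cast at h
  have h5 : (j : ℂ) + 1 + 1 = j + 2 := by ring
  rw [h5] at h
  rw [h]
  linear_combination w * h2

/-- `expPoleCoeff` at `n z`, normalized by `exp (-n z)`. -/
def expPoleRatio (j n : ℕ) (z : ℂ) : ℂ := Complex.exp (-(n * z)) * expPoleCoeff j n (n * z)

lemma expPoleRatio_one (n : ℕ) (z : ℂ) :
    expPoleRatio 1 n z = (n + 1 - n * z) * expPoleRatio 0 n z +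
      n * z * (stirlingFactor n * phi z ^ n) := by
  have h7 : (stirlingFactor n : ℂ) = (n : ℂ) ^ n * Complex.exp (-n) / n.factorial := by
    simp [stirlingFactor]
  have h10 := Complex.exp_ne_zero (n : ℂ)
  have h1 : (stirlingFactor n : ℂ) * phi z ^ n =
      Complex.exp (-(n * z)) * ((n * z) ^ n / n.factorial) := by
    rw [phi_pow, h7, Complex.exp_neg (n : ℂ), mul_pow]
    field_simp
  rw [h1, expPoleRatio, expPoleRatio, expPoleCoeff_one]
  ring

lemma expPoleRatio_add_two (j n : ℕ) (z : ℂ) :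
    expPoleRatio (j + 2) n z = ((n + j + 2 - n * z) * expPoleRatio (j + 1) n z +
      n * z * expPoleRatio j n z) / (j + 2) := by
  have h : (j : ℂ) + 2 ≠ 0 := by exact_mod_cast (j + 1).succ_ne_zero
  rw [eq_div_iff h]
  simp only [expPoleRatio]
  linear_combination Complex.exp (-(n * z)) * expPoleCoeff_add_two j n (n * z)

lemma expPoleRatio_zero (n : ℕ) (z : ℂ) :
    expPoleRatio 0 n z = 1 - stirlingFactor n * phi z ^ n * expTail n z :=
  exp_mul_expPoleCoeff_zero n z

lemma tendsto_inv_fst (z : ℂ) :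
    Tendsto (fun p : ℕ × ℂ => ((p.1 : ℂ))⁻¹) (atTop ×ˢ 𝓝 z) (𝓝 0) :=
  (tendsto_inv_atTop_nhds_zero_nat (𝕜 := ℂ)).comp tendsto_fst

lemma tendsto_stirlingFactor_mul_pow (N : ℕ) {f : ℂ → ℂ} {x : ℂ} (hf : ContinuousAt f x)
    (h1 : ‖f x‖ < 1) :
    Tendsto (fun p : ℕ × ℂ => (p.1 : ℂ) ^ N * (stirlingFactor p.1 * f p.2 ^ p.1))
      (atTop ×ˢ 𝓝 x) (𝓝 0) := by
  refine squeeze_zero_norm (fun p => ?_)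
    (tendsto_pow_mul_pow_prod N hf.norm (fun z => norm_nonneg _) h1)
  rw [norm_mul, norm_mul, norm_pow, norm_pow, Complex.norm_real,
    Real.norm_of_nonneg (stirlingFactor_pos _).le, Complex.norm_natCast]
  have := mul_le_mul_of_nonneg_right (stirlingFactor_le_one p.1)
    (by positivity : 0 ≤ ‖f p.2‖ ^ p.1)
  rw [one_mul] at this
  gcongr

lemma tendsto_expPoleRatio_zero {z : ℂ} (hz : ‖z‖ < 1) (hphi : ‖phi z‖ < 1) :
    Tendsto (fun p : ℕ × ℂ => expPoleRatio 0 p.1 p.2) (atTop ×ˢ 𝓝 z) (𝓝 1) := by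
  have h1 := tendsto_stirlingFactor_mul_pow 0 continuous_phi.continuousAt hphi
  have h2 := (tendsto_const_nhds (x := (1 : ℂ))).sub (h1.mul (tendsto_expTail hz))
  simp only [pow_zero, one_mul, zero_mul, sub_zero] at h2
  exact h2.congr fun p => (expPoleRatio_zero p.1 p.2).symm

/-- Divided by n^(j+2), the recurrence multiplies the previous limit by (1-z)/(j+2); the term of
order j is smaller by a factor 1/n. -/
lemma tendsto_expPoleRatio (j : ℕ) {z : ℂ} (hz : ‖z‖ < 1) (hphi : ‖phi z‖ < 1) :
    Tendsto (fun p : ℕ × ℂ => expPoleRatio j p.1 p.2 / (p.1 : ℂ) ^ j) (atTop ×ˢ 𝓝 z)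
      (𝓝 ((1 - z) ^ j / (j.factorial : ℂ))) := by
  have hsnd : Tendsto (fun p : ℕ × ℂ => p.2) (atTop ×ˢ 𝓝 z) (𝓝 z) := tendsto_snd
  have hinv := tendsto_inv_fst z
  have hn0 : ∀ᶠ p : ℕ × ℂ in atTop ×ˢ 𝓝 z, p.1 ≠ 0 :=
    tendsto_fst.eventually (eventually_ne_atTop 0)
  induction j using Nat.twoStepInduction with
  | zero => simpa using tendsto_expPoleRatio_zero hz hphi
  | one =>
    have h1 := tendsto_stirlingFactor_mul_pow 0 continuous_phi.continuousAt hphi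
    have h2 := (((hinv.const_add 1).sub hsnd).mul (tendsto_expPoleRatio_zero hz hphi)).add
      (hsnd.mul h1)
    simp only [add_zero, mul_one, mul_zero] at h2
    simp only [pow_one, Nat.factorial_one, Nat.cast_one, div_one]
    refine h2.congr' ?_
    filter_upwards [hn0] with p hp
    have hp' : (p.1 : ℂ) ≠ 0 := by exact_mod_cast hp
    rw [expPoleRatio_one]
    field_simp
  | more j ih1 ih2 =>
    have h2 := (((((hinv.const_mul ((j : ℂ) + 2)).const_add 1).sub hsnd).mul ih2).add
      ((hsnd.mul ih1).mul hinv)).div_const ((j : ℂ) + 2)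
    have hj : (j : ℂ) + 2 ≠ 0 := by exact_mod_cast (j + 1).succ_ne_zero
    have h3 : ((1 + ((j : ℂ) + 2) * 0 - z) * ((1 - z) ^ (j + 1) / ((j + 1).factorial : ℂ)) +
        z * ((1 - z) ^ j / (j.factorial : ℂ)) * 0) / ((j : ℂ) + 2) =
        (1 - z) ^ (j + 2) / ((j + 2).factorial : ℂ) := by
      have h4 : ((j + 1).factorial : ℂ) ≠ 0 := by exact_mod_cast (j + 1).factorial_ne_zero
      rw [Nat.factorial_succ (j + 1)]
      have h5 : ((j : ℂ) + 1) + 1 ≠ 0 := by rwa [add_assoc, one_add_one_eq_two]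
      push_cast
      field_simp
      ring
    rw [h3] at h2
    refine h2.congr' ?_
    filter_upwards [hn0] with p hp
    have hp' : (p.1 : ℂ) ≠ 0 := by exact_mod_cast hp
    rw [expPoleRatio_add_two]
    field_simp
    ring

/-- A crude bound for competing poles, valid on either side of |φ(z)| = 1. The exponent N is free
because each step of the recurrence costs a power of n. -/
lemma tendsto_pow_mul_expPoleRatio_div_pow (j N : ℕ) {z : ℂ} {M : ℝ} (hz : ‖z‖ < 1)
    (hM : 1 < M) (hphi : ‖phi z‖ < M) :
    Tendsto (fun p : ℕ × ℂ => (p.1 : ℂ) ^ N * expPoleRatio j p.1 p.2 / (M : ℂ) ^ p.1)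
      (atTop ×ˢ 𝓝 z) (𝓝 0) := by
  have hM0 : 0 < M := by linarith
  have hsnd : Tendsto (fun p : ℕ × ℂ => p.2) (atTop ×ˢ 𝓝 z) (𝓝 z) := tendsto_snd
  have hphi' : ∀ N : ℕ, Tendsto (fun p : ℕ × ℂ => (p.1 : ℂ) ^ N *
      (stirlingFactor p.1 * (phi p.2 / M) ^ p.1)) (atTop ×ˢ 𝓝 z) (𝓝 0) := fun N => by
    refine tendsto_stirlingFactor_mul_pow N (f := fun z => phi z / M)
      (continuous_phi.div_const _).continuousAt ?_
    rw [norm_div, Complex.norm_real, Real.norm_of_nonneg hM0.le]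
    exact (div_lt_one hM0).2 hphi
  have h0 : ∀ N : ℕ, Tendsto (fun p : ℕ × ℂ => (p.1 : ℂ) ^ N * expPoleRatio 0 p.1 p.2 /
      (M : ℂ) ^ p.1) (atTop ×ˢ 𝓝 z) (𝓝 0) := by
    intro N
    have h1 : Tendsto (fun p : ℕ × ℂ => (p.1 : ℂ) ^ N * ((M : ℂ)⁻¹) ^ p.1)
        (atTop ×ˢ 𝓝 z) (𝓝 0) := by
      rw [tendsto_zero_iff_norm_tendsto_zero]
      have := tendsto_pow_mul_pow_prod N (f := fun _ => M⁻¹) (x := z) continuousAt_const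
        (fun _ => by positivity) (inv_lt_one_of_one_lt₀ hM)
      refine this.congr fun p => ?_
      simp [abs_of_pos hM0]
    have h2 := h1.sub ((hphi' N).mul (tendsto_expTail hz))
    simp only [zero_mul, sub_zero] at h2
    refine h2.congr fun p => ?_
    rw [expPoleRatio_zero, div_pow, inv_pow]
    ring
  induction j using Nat.twoStepInduction generalizing N with
  | zero => exact h0 N
  | one =>
    have h2 := (((hsnd.const_sub 1).mul (h0 (N + 1))).add (h0 N)).add
      (hsnd.mul (hphi' (N + 1)))
    simp only [add_zero, mul_zero] at h2
    refine h2.congr fun p => ?_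
    rw [expPoleRatio_one, div_pow]
    ring
  | more j ih1 ih2 =>
    have h2 := ((((hsnd.const_sub 1).mul (ih2 (N + 1))).add
      ((ih2 N).const_mul ((j : ℂ) + 2))).add (hsnd.mul (ih1 (N + 1)))).div_const ((j : ℂ) + 2)
    simp only [add_zero, mul_zero, zero_div] at h2
    refine h2.congr fun p => ?_
    rw [expPoleRatio_add_two]
    ring

/-! ### Negligible poles. -/

lemma norm_poleSum_le (j n : ℕ) {y : ℂ} {R S : ℝ} (hy : ‖y‖ ≤ R) (hRS : R < S) (hS : 1 ≤ S) :
    ‖poleSum j n y‖ ≤ 1 / (1 - R / S) ^ (j + 1) * S ^ n := by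
  have hR0 : 0 ≤ R := (norm_nonneg y).trans hy
  have hS0 : 0 < S := by linarith
  have hr : ‖R / S‖ < 1 := by
    rw [Real.norm_of_nonneg (by positivity)]; exact (div_lt_one hS0).2 hRS
  have h := hasSum_choose_mul_geometric_of_norm_lt_one j hr
  have h1 : ‖poleSum j n y‖ ≤ ∑ k ∈ Finset.range (n + 1),
      ((k + j).choose j : ℝ) * (R / S) ^ k * S ^ n := by
    rw [poleSum, weightedSum]
    refine (norm_sum_le _ _).trans (Finset.sum_le_sum fun k hk => ?_)
    have hk' : k ≤ n := by simpa [Nat.lt_succ_iff] using hk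
    rw [norm_mul, norm_mul, norm_pow, Complex.norm_natCast]
    have h3 : ‖y‖ ^ k ≤ (R / S) ^ k * S ^ n := by
      calc ‖y‖ ^ k ≤ R ^ k := pow_le_pow_left₀ (norm_nonneg _) hy k
        _ = (R / S) ^ k * S ^ k := by rw [div_pow]; field_simp
        _ ≤ _ := mul_le_mul_of_nonneg_left (pow_le_pow_right₀ hS hk') (by positivity)
    calc _ ≤ ((k + j).choose j : ℝ) * 1 * ((R / S) ^ k * S ^ n) := by
          gcongr
          exact norm_fallWeight_le_one n k
      _ = _ := by ring
  rw [← Finset.sum_mul] at h1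
  refine h1.trans (mul_le_mul_of_nonneg_right ?_ (by positivity))
  exact sum_le_hasSum _ (fun k _ => by positivity) h

/-- The contribution of a pole at `b` is negligible against `ψ ^ (-n)`. -/
lemma tendsto_pow_mul_poleSum (j : ℕ) {ψ : ℂ → ℂ} {b x : ℂ} (hb : b ≠ 0) (hx : x ≠ 0)
    (hψ : ContinuousAt ψ x) (h1 : ‖ψ x‖ < 1) (h2 : ‖b * x‖ < 1 → ‖ψ x‖ < ‖phi (b * x)‖) :
    Tendsto (fun p : ℕ × ℂ => stirlingFactor p.1 * ψ p.2 ^ p.1 * poleSum j p.1 (b * p.2)⁻¹)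
      (atTop ×ˢ 𝓝 x) (𝓝 0) := by
  have hbx : b * x ≠ 0 := mul_ne_zero hb hx
  rcases lt_or_ge ‖b * x‖ 1 with h | h
  · have h3 := h2 h
    have hphi : 0 < ‖phi (b * x)‖ := norm_pos_iff.2 (phi_ne_zero hbx)
    -- Both |ψ(x)| < 1 and |ψ(x)| < |φ(bx)| are used to fit M. Since |ψ/φ(b·)| < 1/M near x, the
    -- term, which is (ψ/φ(b·))^n times the normalized sum, is bounded by that sum over M^n.
    obtain ⟨M, hM1, hM2⟩ : ∃ M : ℝ, max 1 ‖phi (b * x)‖ < M ∧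
        M * ‖ψ x‖ < ‖phi (b * x)‖ := by
      have h4 : max 1 ‖phi (b * x)‖ * ‖ψ x‖ < ‖phi (b * x)‖ := by
        rcases max_cases 1 ‖phi (b * x)‖ with ⟨h5, _⟩ | ⟨h5, _⟩ <;> rw [h5]
        · simpa using h3
        · nlinarith
      have h5 : ContinuousAt (fun M : ℝ => M * ‖ψ x‖) (max 1 ‖phi (b * x)‖) := by fun_prop
      obtain ⟨M, hM, hM'⟩ := (((h5.eventually (gt_mem_nhds h4)).filter_mono
        (nhdsWithin_le_nhds (s := Set.Ioi (max 1 ‖phi (b * x)‖)))).and self_mem_nhdsWithin).exists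
      exact ⟨M, hM', hM⟩
    have hM0 : 0 < M := by linarith [le_max_left 1 ‖phi (b * x)‖]
    have hcont : Tendsto (fun p : ℕ × ℂ => (p.1, b * p.2)) (atTop ×ˢ 𝓝 x)
        (atTop ×ˢ 𝓝 (b * x)) := tendsto_id.prodMap (continuous_const_mul b).continuousAt
    have h6 := (tendsto_pow_mul_expPoleRatio_div_pow j 0 h
      ((le_max_left _ _).trans_lt hM1) ((le_max_right _ _).trans_lt hM1)).comp hcont
    rw [tendsto_zero_iff_norm_tendsto_zero] at h6
    refine squeeze_zero_norm' ?_ h6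
    have hc2 : ContinuousAt (fun x => ‖phi (b * x)‖ - M * ‖ψ x‖) x := by
      exact ((continuous_phi.comp (continuous_const_mul b)).continuousAt.norm).sub
        (hψ.norm.const_mul M)
    filter_upwards [tendsto_snd.eventually (hc2.eventually (lt_mem_nhds (sub_pos.2 hM2))),
      tendsto_fst.eventually (eventually_ne_atTop 0),
      tendsto_snd.eventually (isOpen_ne.mem_nhds hx)] with p hp hn hpx
    have hbp : b * p.2 ≠ 0 := mul_ne_zero hb hpx
    have hph : phi (b * p.2) ≠ 0 := phi_ne_zero hbp
    have h7 := poleSum_inv_eq j hn hbp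
    rw [← expPoleRatio] at h7
    have h8 : ψ p.2 ^ p.1 * expPoleRatio j p.1 (b * p.2) / phi (b * p.2) ^ p.1 =
        stirlingFactor p.1 * ψ p.2 ^ p.1 * poleSum j p.1 (b * p.2)⁻¹ := by
      rw [← h7]
      field_simp
    rw [← h8]
    simp only [Function.comp_apply, pow_zero, one_mul]
    rw [norm_div, norm_mul, norm_div, norm_pow, norm_pow, norm_pow, Complex.norm_real,
      Real.norm_of_nonneg hM0.le, div_le_div_iff₀ (by positivity) (by positivity)]
    have h9 : (M * ‖ψ p.2‖) ^ p.1 ≤ ‖phi (b * p.2)‖ ^ p.1 :=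
      pow_le_pow_left₀ (by positivity) (by linarith) _
    rw [mul_pow] at h9
    calc _ = ‖expPoleRatio j p.1 (b * p.2)‖ * (M ^ p.1 * ‖ψ p.2‖ ^ p.1) := by ring
      _ ≤ _ := mul_le_mul_of_nonneg_left h9 (norm_nonneg _)
  -- Here |1/(bx)| ≤ 1, so the pole sum grows at most like S^n for any S > 1, and |ψ|^n absorbs
  -- this.
  · obtain ⟨S, hS1, hS2⟩ : ∃ S : ℝ, 1 < S ∧ S * ‖ψ x‖ < 1 := by
      have h5 : ContinuousAt (fun M : ℝ => M * ‖ψ x‖) 1 := by fun_prop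
      obtain ⟨M, hM, hM'⟩ := (((h5.eventually (gt_mem_nhds (by simpa using h1))).filter_mono
        (nhdsWithin_le_nhds (s := Set.Ioi (1 : ℝ)))).and self_mem_nhdsWithin).exists
      exact ⟨M, hM', hM⟩
    obtain ⟨R, hR1, hRS⟩ := exists_between hS1
    have h3 := (tendsto_pow_mul_pow_prod 0 (f := fun x => S * ‖ψ x‖) (hψ.norm.const_mul S)
      (fun _ => by positivity) hS2).const_mul (1 / (1 - R / S) ^ (j + 1))
    rw [mul_zero] at h3
    refine squeeze_zero_norm' ?_ h3
    have hy : ‖(b * x)⁻¹‖ < R := by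
      rw [norm_inv]; exact (inv_le_one_of_one_le₀ h).trans_lt hR1
    have hc : ContinuousAt (fun x => ‖(b * x)⁻¹‖) x :=
      ((continuous_const_mul b).continuousAt.inv₀ hbx).norm
    filter_upwards [tendsto_snd.eventually (hc.eventually (gt_mem_nhds hy))] with p hp
    rw [norm_mul, norm_mul, norm_pow, Complex.norm_real,
      Real.norm_of_nonneg (stirlingFactor_pos _).le, pow_zero, one_mul, mul_pow]
    calc _ ≤ 1 * ‖ψ p.2‖ ^ p.1 * (1 / (1 - R / S) ^ (j + 1) * S ^ p.1) := by
          gcongr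
          · exact stirlingFactor_le_one _
          · exact norm_poleSum_le j p.1 hp.le hRS hS1.le
      _ = _ := by ring

/-! ### Partial fractions of 1/g. -/

lemma exists_taylor_remainder {h : ℂ → ℂ} {a : ℂ} (ha : a ≠ 0) (hh : AnalyticAt ℂ h a) (m : ℕ) :
    ∃ (d : ℕ → ℂ) (q : ℂ → ℂ), AnalyticAt ℂ q a ∧ ∀ᶠ t in 𝓝 a,
      h t = ∑ i ∈ Finset.range m, d i * (1 - t / a) ^ i + (1 - t / a) ^ m * q t := by
  induction m with
  | zero => exact ⟨0, h, hh, by simp⟩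
  | succ m ih =>
    obtain ⟨d, q, hq, he⟩ := ih
    obtain ⟨p, hp⟩ := hq
    -- The factor -a converts increments in t - a into increments in 1 - t/a.
    refine ⟨Function.update d m (q a), fun t => -a * dslope q a t,
      analyticAt_const.mul hp.has_fpower_series_dslope_fslope.analyticAt, ?_⟩
    filter_upwards [he] with t ht
    have h1 : q t = q a + (1 - t / a) * (-a * dslope q a t) := by
      have h2 := sub_smul_dslope q a t
      rw [smul_eq_mul] at h2
      have h3 : (1 - t / a) * -a = t - a := by field_simp; ring
      rw [← mul_assoc, h3, h2]
      ring
    have h4 : ∑ i ∈ Finset.range m, Function.update d m (q a) i * (1 - t / a) ^ i =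
        ∑ i ∈ Finset.range m, d i * (1 - t / a) ^ i := by
      refine Finset.sum_congr rfl fun i hi => ?_
      rw [Function.update_of_ne (Finset.mem_range.1 hi).ne]
    rw [ht, Finset.sum_range_succ, h4, Function.update_self]
    nth_rewrite 1 [h1]
    ring

/-- Write g = (t-a)^(m+1) k with k(a) ≠ 0 and expand 1/((-a)^(m+1) k) to order m+1 in 1 - t/a. The
order of the coefficients is reversed, so the leading one is the value at a, which is nonzero. -/
lemma exists_principal_part {g : ℂ → ℂ} {a : ℂ} (ha : a ≠ 0) (hg : AnalyticAt ℂ g a)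
    (hga : g a = 0) (hne : ¬∀ᶠ t in 𝓝 a, g t = 0) :
    ∃ (m : ℕ) (C : ℕ → ℂ) (q : ℂ → ℂ), C m ≠ 0 ∧ AnalyticAt ℂ q a ∧ ∀ᶠ t in 𝓝[≠] a,
      1 / g t = q t + ∑ j ∈ Finset.range (m + 1), C j / (1 - t / a) ^ (j + 1) := by
  obtain ⟨n, k, hk, hka, hgk⟩ := hg.exists_eventuallyEq_pow_smul_nonzero_iff.2 hne
  obtain ⟨m, rfl⟩ : ∃ m, n = m + 1 := by
    refine Nat.exists_eq_succ_of_ne_zero ?_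
    rintro rfl
    have := hgk.self_of_nhds
    simp only [pow_zero, one_smul] at this
    exact hka (this ▸ hga)
  have hH : AnalyticAt ℂ (fun t => ((-a) ^ (m + 1) * k t)⁻¹) a :=
    (analyticAt_const.mul hk).inv (mul_ne_zero (pow_ne_zero _ (neg_ne_zero.2 ha)) hka)
  obtain ⟨d, q, hq, hd⟩ := exists_taylor_remainder ha hH (m + 1)
  refine ⟨m, fun j => d (m - j), q, ?_, hq, ?_⟩
  · have h1 := hd.self_of_nhds
    rw [div_self ha, sub_self, Finset.sum_range_succ'] at h1
    simp only [ne_eq, Nat.add_eq_zero_iff, one_ne_zero, and_false, not_false_eq_true, zero_pow,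
      mul_zero, Finset.sum_const_zero, pow_zero, mul_one, zero_add, zero_mul, add_zero] at h1
    simp only [Nat.sub_self]
    rw [← h1]
    exact inv_ne_zero (mul_ne_zero (pow_ne_zero _ (neg_ne_zero.2 ha)) hka)
  · filter_upwards [hgk.filter_mono nhdsWithin_le_nhds, hd.filter_mono nhdsWithin_le_nhds,
      self_mem_nhdsWithin] with t h1 h2 h3
    have h4 : 1 - t / a ≠ 0 := by
      rw [sub_ne_zero, ne_comm]
      intro h
      exact h3 ((div_eq_one_iff_eq ha).1 h)
    have h5 : t - a = (1 - t / a) * -a := by field_simp; ring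
    have h6 : 1 / g t = ((-a) ^ (m + 1) * k t)⁻¹ / (1 - t / a) ^ (m + 1) := by
      rw [h1, smul_eq_mul, h5, mul_pow, one_div, mul_assoc, mul_inv, mul_comm,
        ← div_eq_mul_inv]
    rw [h6, h2, ← Finset.sum_range_reflect, add_div, mul_div_cancel_left₀ _ (pow_ne_zero _ h4),
      add_comm, Finset.sum_div]
    congr 1
    refine Finset.sum_congr rfl fun j hj => ?_
    have hj' : j < m + 1 := Finset.mem_range.1 hj
    have h7 : m + 1 - 1 - j = m - j := by omega
    have h8 : (1 - t / a) ^ (m + 1) = (1 - t / a) ^ (m - j) * (1 - t / a) ^ (j + 1) := by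
      rw [← pow_add]; congr 1; omega
    rw [h7, h8, mul_comm (d _), mul_div_mul_left _ _ (pow_ne_zero _ h4)]

lemma differentiableAt_pole {a t : ℂ} (ha : a ≠ 0) (hta : t ≠ a) (c : ℂ) (j : ℕ) :
    DifferentiableAt ℂ (fun t => c / (1 - t / a) ^ (j + 1)) t := by
  have h : (1 - t / a) ^ (j + 1) ≠ 0 := by
    refine pow_ne_zero _ (sub_ne_zero.2 fun h => hta ?_)
    exact (div_eq_one_iff_eq ha).1 h.symm
  fun_prop (disch := assumption)

/-- The partial fraction expansion of `1 / g` in a disk. -/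
lemma exists_partial_fractions {g : ℂ → ℂ} (hg : Differentiable ℂ g) (hg0 : g 0 ≠ 0) {R : ℝ}
    {S : Finset ℂ} (hS : ∀ a, a ∈ S ↔ g a = 0 ∧ ‖a‖ < R) :
    ∃ (m : ℂ → ℕ) (C : ℂ → ℕ → ℂ) (G : ℂ → ℂ), (∀ a ∈ S, C a (m a) ≠ 0) ∧
      DifferentiableOn ℂ G (Metric.ball 0 R) ∧ ∀ t, ‖t‖ < R → g t ≠ 0 →
        1 / g t = G t + ∑ a ∈ S, ∑ j ∈ Finset.range (m a + 1), C a j / (1 - t / a) ^ (j + 1) := by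
  classical
  have hS0 : ∀ a ∈ S, a ≠ 0 := by
    rintro a ha rfl
    exact hg0 ((hS 0).1 ha).1
  have hloc : ∀ a : ℂ, ∃ (m : ℕ) (C : ℕ → ℂ) (q : ℂ → ℂ), a ∈ S → C m ≠ 0 ∧ AnalyticAt ℂ q a ∧
      ∀ᶠ t in 𝓝[≠] a,
        1 / g t = q t + ∑ j ∈ Finset.range (m + 1), C j / (1 - t / a) ^ (j + 1) := by
    intro a
    by_cases ha : a ∈ S
    · have hne : ¬∀ᶠ t in 𝓝 a, g t = 0 := by
        intro h
        have h1 := AnalyticOnNhd.eqOn_zero_of_preconnected_of_eventuallyEq_zero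
          (fun z _ => hg.analyticAt z) isPreconnected_univ (Set.mem_univ a) h
        exact hg0 (h1 (Set.mem_univ 0))
      obtain ⟨m, C, q, h⟩ := exists_principal_part (hS0 a ha) (hg.analyticAt a)
        ((hS a).1 ha).1 hne
      exact ⟨m, C, q, fun _ => h⟩
    · exact ⟨0, 0, 0, fun h => absurd h ha⟩
  choose m C q hmCq using hloc
  set P : ℂ → ℂ → ℂ := fun a t => ∑ j ∈ Finset.range (m a + 1), C a j / (1 - t / a) ^ (j + 1)
    with hP
  have hPd : ∀ a ∈ S, ∀ t, t ≠ a → DifferentiableAt ℂ (P a) t := fun a ha t hta =>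
    DifferentiableAt.fun_sum fun j _ => differentiableAt_pole (hS0 a ha) hta _ _
  -- At a pole, the value is the one that removes the singularity: the local regular part minus the
  -- principal parts at the other poles.
  set G : ℂ → ℂ := fun t => if t ∈ S then q t t - ∑ b ∈ S.erase t, P b t
    else 1 / g t - ∑ b ∈ S, P b t with hG
  refine ⟨m, C, G, fun a ha => (hmCq a ha).1, ?_, ?_⟩
  · intro t ht
    have htR : ‖t‖ < R := by simpa using ht
    apply DifferentiableAt.differentiableWithinAt
    have hfar : ∀ᶠ s in 𝓝[≠] t, s ∉ S := by
      have h1 : ((S.erase t : Finset ℂ) : Set ℂ)ᶜ ∈ 𝓝 t :=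
        (S.erase t).finite_toSet.isClosed.isOpen_compl.mem_nhds (by simp)
      filter_upwards [nhdsWithin_le_nhds h1, self_mem_nhdsWithin] with s hs hst hsS
      exact hs (Finset.mem_coe.2 (Finset.mem_erase.2 ⟨hst, hsS⟩))
    by_cases htS : t ∈ S
    · obtain ⟨_, hq, he⟩ := hmCq t htS
      have hd : DifferentiableAt ℂ (fun s => q t s - ∑ b ∈ S.erase t, P b s) t :=
        hq.differentiableAt.sub (DifferentiableAt.fun_sum fun b hb =>
          hPd b (Finset.mem_of_mem_erase hb) t (Finset.ne_of_mem_erase hb).symm)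
      refine hd.congr_of_eventuallyEq ?_
      refine eventuallyEq_nhds_of_eventuallyEq_nhdsNE ?_ (by simp [hG, htS])
      filter_upwards [hfar, he] with s hs he'
      simp only [hG, hs, if_false]
      rw [he', ← Finset.add_sum_erase S (fun b => P b s) htS]
      simp only [hP]
      ring
    · have hgt : g t ≠ 0 := fun h => htS ((hS t).2 ⟨h, htR⟩)
      have hd : DifferentiableAt ℂ (fun s => 1 / g s - ∑ b ∈ S, P b s) t :=
        ((differentiableAt_const _).div (hg t) hgt).sub (DifferentiableAt.fun_sum fun b hb =>
          hPd b hb t fun h => htS (h ▸ hb))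
      refine hd.congr_of_eventuallyEq ?_
      refine eventuallyEq_nhds_of_eventuallyEq_nhdsNE ?_ (by simp [hG, htS])
      filter_upwards [hfar] with s hs
      simp only [hG, hs, if_false]
  · intro t _ hgt
    have htS : t ∉ S := fun h => hgt ((hS t).1 h).1
    simp only [hG, htS, if_false, hP]
    ring

lemma weightedSum_add (c d : ℕ → ℂ) (n : ℕ) (y : ℂ) :
    weightedSum (fun k => c k + d k) n y = weightedSum c n y + weightedSum d n y := by
  simp only [weightedSum, ← Finset.sum_add_distrib, add_mul]

lemma weightedSum_sum {ι : Type*} (s : Finset ι) (c : ι → ℕ → ℂ) (n : ℕ) (y : ℂ) :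
    weightedSum (fun k => ∑ i ∈ s, c i k) n y = ∑ i ∈ s, weightedSum (c i) n y := by
  simp only [weightedSum, Finset.sum_mul]
  exact Finset.sum_comm

lemma weightedSum_pole (j n : ℕ) (c a y : ℂ) :
    weightedSum (fun k => c * (((k + j).choose j : ℂ) * a⁻¹ ^ k)) n y =
      c * poleSum j n (y / a) := by
  rw [poleSum, weightedSum, weightedSum, Finset.mul_sum]
  refine Finset.sum_congr rfl fun k _ => ?_
  rw [div_eq_mul_inv, mul_pow]
  ring

/-- Taylor coefficients are compared near 0 only, where every pole term is given by its power
series. The result is an identity between polynomials in y, hence valid for every y. -/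
lemma weightedSum_partial_fractions {g G : ℂ → ℂ} (hg : Differentiable ℂ g) (hg0 : g 0 ≠ 0)
    {R : ℝ} (hR : 0 < R) {S : Finset ℂ} (hS : ∀ a ∈ S, g a = 0) {m : ℂ → ℕ} {C : ℂ → ℕ → ℂ}
    (hG : DifferentiableOn ℂ G (Metric.ball 0 R))
    (h : ∀ t, ‖t‖ < R → g t ≠ 0 → 1 / g t =
      G t + ∑ a ∈ S, ∑ j ∈ Finset.range (m a + 1), C a j / (1 - t / a) ^ (j + 1))
    (n : ℕ) (y : ℂ) :
    weightedSum (taylorCoeff fun t => 1 / g t) n y = weightedSum (taylorCoeff G) n y +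
      ∑ a ∈ S, ∑ j ∈ Finset.range (m a + 1), C a j * poleSum j n (y / a) := by
  obtain ⟨r, hr, hgr⟩ := Metric.eventually_nhds_iff.1
    (hg.continuous.continuousAt.eventually_ne hg0)
  have h1 : taylorCoeff (fun t => 1 / g t) = fun k => taylorCoeff G k +
      ∑ a ∈ S, ∑ j ∈ Finset.range (m a + 1), C a j * (((k + j).choose j : ℂ) * a⁻¹ ^ k) := by
    funext k
    refine taylorCoeff_eq_of_hasSum (c := fun k => taylorCoeff G k + ∑ a ∈ S,
      ∑ j ∈ Finset.range (m a + 1), C a j * (((k + j).choose j : ℂ) * a⁻¹ ^ k))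
      (lt_min hr hR) (fun t ht => ?_) k
    rw [h t (ht.trans_le (min_le_right _ _))
      (hgr (by simpa using ht.trans_le (min_le_left _ _)))]
    simp only [add_mul, Finset.sum_mul]
    refine (hasSum_taylorCoeff hG (ht.trans_le (min_le_right _ _))).add
      (hasSum_sum fun a ha => hasSum_sum fun j _ => ?_)
    have hta : ‖t‖ < ‖a‖ := by
      refine (ht.trans_le (min_le_left _ _)).trans_le ?_
      by_contra! hlt
      exact hgr (by simpa using hlt) (hS a ha)
    have ha0 : 0 < ‖a‖ := (norm_nonneg t).trans_lt hta
    have h2 : ‖t / a‖ < 1 := by rw [norm_div]; exact (div_lt_one ha0).2 hta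
    have h3 := (hasSum_choose_mul_geometric_of_norm_lt_one j h2).mul_left (C a j)
    rw [mul_one_div] at h3
    refine h3.congr_fun fun k => ?_
    rw [div_eq_mul_inv t, mul_pow]
    ring
  rw [h1, weightedSum_add, weightedSum_sum]
  simp only [weightedSum_sum, weightedSum_pole]

/-! ### Geometry of |φ| and of the regions D₀ and D_a. -/

lemma norm_phi (z : ℂ) : ‖phi z‖ = ‖z‖ * Real.exp (1 - z.re) := by
  rw [phi, norm_mul, Complex.norm_exp]
  simp

lemma exp_neg_le_quadratic {v : ℝ} (hv : 0 ≤ v) : Real.exp (-v) ≤ 1 - v + v ^ 2 / 2 := by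
  have h1 := Real.quadratic_le_exp_of_nonneg hv
  have h2 : 0 < 1 + v + v ^ 2 / 2 := by positivity
  rw [Real.exp_neg]
  refine (inv_anti₀ h2 h1).trans ?_
  rw [inv_le_iff_one_le_mul₀ h2]
  nlinarith [sq_nonneg (v ^ 2)]

/-- The region bounded by the Szegő curve lies in a sector of opening `π / 2` at its corner. -/
lemma abs_im_le_one_sub_re {c : ℂ} (hc : ‖c‖ ≤ 1) (hphi : ‖phi c‖ ≤ 1) : |c.im| ≤ 1 - c.re := by
  have hre : 0 ≤ 1 - c.re := by linarith [Complex.re_le_norm c]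
  rw [norm_phi] at hphi
  have h1 : ‖c‖ ≤ Real.exp (-(1 - c.re)) := by
    rw [Real.exp_neg, ← one_div]
    exact (le_div_iff₀ (Real.exp_pos _)).2 hphi
  have h2 : ‖c‖ ^ 2 ≤ Real.exp (-(2 * (1 - c.re))) := by
    calc ‖c‖ ^ 2 ≤ Real.exp (-(1 - c.re)) ^ 2 := pow_le_pow_left₀ (norm_nonneg _) h1 2
      _ = _ := by rw [← Real.exp_nat_mul]; congr 1; push_cast; ring
  -- With u = 1 - Re c this reads (1-u)² + (Im c)² ≤ 1 - 2u + 2u², that is, (Im c)² ≤ u².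
  have h3 := exp_neg_le_quadratic (v := 2 * (1 - c.re)) (by linarith)
  rw [Complex.sq_norm, Complex.normSq_apply] at h2
  refine abs_le_of_sq_le_sq ?_ hre
  nlinarith

/-- Real part of 1 - cz = (1-c) + (1-z) - (1-c)(1-z). -/
lemma norm_phi_mul (c z : ℂ) :
    ‖phi (c * z)‖ = ‖phi c‖ * ‖phi z‖ * Real.exp (-((1 - c) * (1 - z)).re) := by
  rw [norm_phi, norm_phi, norm_phi, norm_mul]
  have : Real.exp (1 - (c * z).re) = Real.exp (1 - c.re) * Real.exp (1 - z.re) *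
      Real.exp (-((1 - c) * (1 - z)).re) := by
    rw [← Real.exp_add, ← Real.exp_add]
    congr 1
    simp only [Complex.mul_re, Complex.sub_re, Complex.one_re, Complex.sub_im, Complex.one_im]
    ring
  rw [this]
  ring

/-- `|φ|` is submultiplicative on the closed region bounded by the Szegő curve. -/
lemma norm_phi_mul_le {c z : ℂ} (hc : ‖c‖ ≤ 1) (hc' : ‖phi c‖ ≤ 1) (hz : ‖z‖ ≤ 1)
    (hz' : ‖phi z‖ ≤ 1) : ‖phi (c * z)‖ ≤ ‖phi c‖ * ‖phi z‖ := by
  rw [norm_phi_mul]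
  refine mul_le_of_le_one_right (by positivity) (Real.exp_le_one_iff.2 ?_)
  -- Both 1-c and 1-z lie in the sector |arg| ≤ π/4 (or vanish), so their product has nonnegative
  -- real part.
  have h1 := abs_le.1 (abs_im_le_one_sub_re hc hc')
  have h2 := abs_le.1 (abs_im_le_one_sub_re hz hz')
  simp only [Complex.mul_re, Complex.sub_re, Complex.one_re, Complex.sub_im, Complex.one_im]
  nlinarith [mul_nonneg (sub_nonneg.2 h1.2) (sub_nonneg.2 h2.2), mul_nonneg
    (neg_le_iff_add_nonneg.1 h1.1) (neg_le_iff_add_nonneg.1 h2.1),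
    mul_nonneg (sub_nonneg.2 h1.2) (neg_le_iff_add_nonneg.1 h2.1),
    mul_nonneg (neg_le_iff_add_nonneg.1 h1.1) (sub_nonneg.2 h2.2)]

lemma norm_phi_ofReal_lt_one {t : ℝ} (ht0 : 0 ≤ t) (ht : t < 1) : ‖phi t‖ < 1 := by
  rw [norm_phi, Complex.norm_real, Real.norm_of_nonneg ht0, Complex.ofReal_re]
  have h := Real.add_one_lt_exp (x := t - 1) (by linarith)
  have h2 : Real.exp (1 - t) * Real.exp (t - 1) = 1 := by
    rw [← Real.exp_add]; simp
  nlinarith [Real.exp_pos (1 - t)]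

lemma norm_phi_ofReal_mul_lt_one {t : ℝ} (ht0 : 0 ≤ t) (ht : t < 1) {z : ℂ} (hz : ‖z‖ ≤ 1)
    (hz' : ‖phi z‖ ≤ 1) : ‖phi (t * z)‖ < 1 := by
  have h1 := norm_phi_ofReal_lt_one ht0 ht
  have h2 := norm_phi_mul_le (c := t) (z := z)
    (by rw [Complex.norm_real, Real.norm_of_nonneg ht0]; exact ht.le) h1.le hz hz'
  exact h2.trans_lt ((mul_le_of_le_one_right (norm_nonneg _) hz').trans_lt h1)

/-- On the segment from 0 to x, endpoint excluded, |φ(a·)| < 1 and so Φ > 1. The segment lies in the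
component of 0, and x in its closure. -/
lemma mem_D0_of_isDominant {g : ℂ → ℂ} {a x : ℂ} (ha : IsDominant g a) (h1 : ‖a * x‖ ≤ 1)
    (h2 : ‖phi (a * x)‖ ≤ 1) : x ∈ D0 g := by
  set F : ℝ → ℂ := fun t => t * x with hF
  have hFc : Continuous F := by fun_prop
  have hsub : F '' Set.Ico 0 1 ⊆ {x | Phi g x ≠ 1} := by
    rintro _ ⟨t, ht, rfl⟩
    have h3 : ‖phi (a * F t)‖ < 1 := by
      have := norm_phi_ofReal_mul_lt_one ht.1 ht.2 h1 h2
      rwa [← mul_assoc, mul_comm (t : ℂ) a, mul_assoc] at this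
    have h4 : ‖phi (a * F t)‖ₑ < 1 := by
      rw [← ofReal_norm, ← ENNReal.ofReal_one]
      exact (ENNReal.ofReal_lt_ofReal_iff zero_lt_one).2 h3
    have h5 : 1 < Phi g (F t) := by
      refine (ENNReal.one_lt_inv.2 h4).trans_le ?_
      exact le_iSup₂_of_le (f := fun a (_ : a ∈ {a | IsDominant g a}) =>
        (‖phi (a * F t)‖ₑ)⁻¹) a ha le_rfl
    exact h5.ne'
  have h0 : (0 : ℂ) ∈ F '' Set.Ico 0 1 := ⟨0, by simp, by simp [hF]⟩
  have hpre : IsPreconnected (F '' Set.Ico 0 1) := isPreconnected_Ico.image F hFc.continuousOn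
  have hcomp := hpre.subset_connectedComponentIn h0 hsub
  have hx : x ∈ closure (F '' Set.Ico 0 1) := by
    have h6 : (1 : ℝ) ∈ closure (Set.Ico (0 : ℝ) 1) := by
      rw [closure_Ico zero_ne_one]; simp
    have := image_closure_subset_closure_image hFc ⟨1, h6, rfl⟩
    simpa [hF] using this
  exact closure_mono hcomp hx

/-- The region of a zero that is not dominant lies in that of a zero of minimal modulus. -/
lemma exists_isDominant_norm_phi_lt {g : ℂ → ℂ} (hg0 : g 0 ≠ 0) {a x : ℂ} (ha : a ∈ zeros g)
    (hnd : ¬IsDominant g a) (hx : x ≠ 0) (h1 : ‖a * x‖ ≤ 1) (h2 : ‖phi (a * x)‖ ≤ 1) :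
    ∃ b, IsDominant g b ∧ ‖b * x‖ ≤ 1 ∧ ‖phi (b * x)‖ < ‖phi (a * x)‖ := by
  have ha0 : a ≠ 0 := by
    rintro rfl
    exact hg0 ha
  simp only [IsDominant, not_and_or, not_or, not_forall, not_not] at hnd
  rcases hnd with h | ⟨_, b, hb, hbr, hbi⟩
  · exact absurd ha h
  -- Non-dominance puts b/a in the interior of the Szegő curve, so submultiplicativity bounds
  -- |φ(bx)| by |φ(b/a)| |φ(ax)|.
  · have h3 : b * x = (b * (1 / a)) * (a * x) := by field_simp
    refine ⟨b, ⟨hb, Or.inl hbr⟩, ?_, ?_⟩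
    · rw [h3, norm_mul]
      exact mul_le_one₀ hbi.1.le (norm_nonneg _) h1
    · rw [h3]
      refine (norm_phi_mul_le hbi.1.le hbi.2.le h1 h2).trans_lt ?_
      exact mul_lt_of_lt_one_left (norm_pos_iff.2 (phi_ne_zero (mul_ne_zero ha0 hx))) hbi.2

lemma mem_D0_of_zero {g : ℂ → ℂ} (hg0 : g 0 ≠ 0) {a x : ℂ} (ha : a ∈ zeros g) (hx : x ≠ 0)
    (h1 : ‖a * x‖ ≤ 1) (h2 : ‖phi (a * x)‖ ≤ 1) : x ∈ D0 g := by
  by_cases hd : IsDominant g a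
  · exact mem_D0_of_isDominant hd h1 h2
  · obtain ⟨b, hb, h3, h4⟩ := exists_isDominant_norm_phi_lt hg0 ha hd hx h1 h2
    exact mem_D0_of_isDominant hb h3 (h4.le.trans h2)

/-- An interior point can be pushed radially outwards within D_a; shrinking back makes both
inequalities strict. -/
lemma norm_lt_one_of_mem_interior_Da {g : ℂ → ℂ} {a x : ℂ}
    (hx : x ∈ interior (Da g a)) : ‖a * x‖ < 1 ∧ ‖phi (a * x)‖ < 1 := by
  have hcont : ContinuousAt (fun t : ℝ => (t : ℂ)⁻¹ * x) 1 := by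
    have : ((1 : ℝ) : ℂ) ≠ 0 := by simp
    fun_prop (disch := assumption)
  have h1 : ∀ᶠ t : ℝ in 𝓝 1, (t : ℂ)⁻¹ * x ∈ Da g a := by
    refine hcont.eventually (mem_interior_iff_mem_nhds.1 ?_)
    simpa using hx
  have h2 : ∀ᶠ t : ℝ in 𝓝[<] 1, 0 < t := by
    filter_upwards [nhdsWithin_le_nhds (lt_mem_nhds (zero_lt_one (α := ℝ)))] with t ht using ht
  obtain ⟨t, ⟨ht1, ht0⟩, ht⟩ :=
    (((h1.filter_mono nhdsWithin_le_nhds).and h2).and self_mem_nhdsWithin).exists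
  have ht1' : t < 1 := ht
  obtain ⟨-, -, h3, h4⟩ := ht1
  have htC : (t : ℂ) ≠ 0 := by exact_mod_cast ht0.ne'
  have h5 : a * x = t * (a * ((t : ℂ)⁻¹ * x)) := by field_simp
  constructor
  · rw [h5, norm_mul, Complex.norm_real, Real.norm_of_nonneg ht0.le]
    have : 0 ≤ ‖a * ((t : ℂ)⁻¹ * x)‖ := norm_nonneg _
    nlinarith
  · rw [h5]
    exact norm_phi_ofReal_mul_lt_one ht0.le ht1' h4 h3

/-- The quotient |φ(ax)|/|φ(bx)| equals |a/b| e^(Re((b-a)x)). It strictly increases in the direction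
of the conjugate of b-a, so it cannot already be 1 at an interior point. -/
lemma norm_phi_lt_of_mem_interior_Da {g : ℂ → ℂ} {a b x : ℂ} (ha : a ≠ 0)
    (hbd : IsDominant g b) (hab : b ≠ a) (hx0 : x ≠ 0) (hx : x ∈ interior (Da g a)) :
    ‖phi (a * x)‖ < ‖phi (b * x)‖ := by
  set u : ℂ := (starRingEnd ℂ) (b - a) with hu
  have hcont : ContinuousAt (fun t : ℝ => x + t * u) 0 := by fun_prop
  have h1 : ∀ᶠ t : ℝ in 𝓝 0, x + t * u ∈ Da g a ∧ x + t * u ≠ 0 := by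
    refine (hcont.eventually (mem_interior_iff_mem_nhds.1 ?_)).and
      (hcont.eventually_ne ?_) <;> simpa
  obtain ⟨t, ⟨ht1, htne⟩, ht⟩ :=
    ((h1.filter_mono (nhdsWithin_le_nhds (s := Set.Ioi 0))).and self_mem_nhdsWithin).exists
  have ht0 : 0 < t := ht
  have hle := ht1.2.1 b hbd hab
  have key : ∀ y : ℂ, y ≠ 0 → (‖phi (a * y)‖ ≤ ‖phi (b * y)‖ ↔
      ‖a‖ * Real.exp (((b - a) * y).re) ≤ ‖b‖) ∧ (‖phi (a * y)‖ < ‖phi (b * y)‖ ↔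
      ‖a‖ * Real.exp (((b - a) * y).re) < ‖b‖) := by
    intro y hy
    have h2 : ‖phi (a * y)‖ = (‖a‖ * Real.exp (((b - a) * y).re)) *
        (‖y‖ * Real.exp (1 - (b * y).re)) := by
      rw [norm_phi, norm_mul]
      have : Real.exp (1 - (a * y).re) =
          Real.exp (((b - a) * y).re) * Real.exp (1 - (b * y).re) := by
        rw [← Real.exp_add]
        congr 1
        rw [sub_mul, Complex.sub_re]
        ring
      rw [this]; ring
    have h3 : ‖phi (b * y)‖ = ‖b‖ * (‖y‖ * Real.exp (1 - (b * y).re)) := by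
      rw [norm_phi, norm_mul, mul_assoc]
    have h4 : 0 < ‖y‖ * Real.exp (1 - (b * y).re) :=
      mul_pos (norm_pos_iff.2 hy) (Real.exp_pos _)
    rw [h2, h3]
    exact ⟨mul_le_mul_iff_left₀ h4, mul_lt_mul_iff_left₀ h4⟩
  rw [(key x hx0).2]
  refine lt_of_lt_of_le ?_ ((key _ htne).1.1 hle)
  refine mul_lt_mul_of_pos_left (Real.exp_lt_exp.2 ?_) (norm_pos_iff.2 ha)
  have h5 : ((b - a) * (x + t * u)).re = ((b - a) * x).re + t * Complex.normSq (b - a) := by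
    rw [mul_add, mul_left_comm, hu, Complex.mul_conj, Complex.add_re, ← Complex.ofReal_mul,
      Complex.ofReal_re]
  rw [h5]
  have := Complex.normSq_pos.2 (sub_ne_zero.2 hab)
  nlinarith [mul_pos ht0 this]

/-! ### Assembling the three limits. -/

lemma finite_zeros_inter_closedBall {g : ℂ → ℂ} (hg : Differentiable ℂ g) (hg0 : g 0 ≠ 0)
    (R : ℝ) : (zeros g ∩ Metric.closedBall 0 R).Finite := by
  by_contra hinf
  obtain ⟨z, -, hz⟩ := Set.Infinite.exists_accPt_of_subset_isCompact hinf
    (isCompact_closedBall (0 : ℂ) R) Set.inter_subset_right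
  have h1 : ∃ᶠ w in 𝓝[≠] z, g w = 0 :=
    (accPt_iff_frequently_nhdsNE.1 hz).mono fun w hw => hw.1
  exact hg0 (AnalyticOnNhd.eqOn_zero_of_preconnected_of_frequently_eq_zero
    (fun z _ => hg.analyticAt z) isPreconnected_univ (Set.mem_univ z) h1 (Set.mem_univ 0))

lemma exists_radius_finset_zeros {g : ℂ → ℂ} (hg : Differentiable ℂ g) (hg0 : g 0 ≠ 0) (ρ : ℝ) :
    ∃ (R : ℝ) (S : Finset ℂ), ρ < R ∧ (∀ a, a ∈ S ↔ g a = 0 ∧ ‖a‖ < R) := by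
  have hF := finite_zeros_inter_closedBall hg hg0 (ρ + 1)
  obtain ⟨R, hR1, hR2⟩ := exists_between (lt_add_one ρ)
  have hfin : {a | g a = 0 ∧ ‖a‖ < R}.Finite :=
    hF.subset fun a ha => ⟨ha.1, by simpa using (ha.2.trans hR2).le⟩
  exact ⟨R, hfin.toFinset, hR1, fun a => by simp⟩

lemma tendsto_one_div_mul_log {f : ℕ → ℂ → ℂ} {x c : ℂ} (hc : c ≠ 0)
    (h : Tendsto (fun p : ℕ × ℂ => f p.1 p.2) (atTop ×ˢ 𝓝 x) (𝓝 c)) :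
    Tendsto (fun p : ℕ × ℂ => 1 / (p.1 : ℝ) * Real.log ‖f p.1 p.2‖) (atTop ×ˢ 𝓝 x) (𝓝 0) := by
  have h1 : Tendsto (fun p : ℕ × ℂ => 1 / (p.1 : ℝ)) (atTop ×ˢ 𝓝 x) (𝓝 0) :=
    tendsto_one_div_atTop_nhds_zero_nat.comp tendsto_fst
  simpa using h1.mul (h.norm.log (norm_ne_zero_iff.2 hc))

lemma tendsto_fnorm {g : ℂ → ℂ} (hg : Differentiable ℂ g) (hg0 : g 0 ≠ 0) {x c : ℂ}
    (hx : x ≠ 0) (h : Tendsto (fun p : ℕ × ℂ => weightedSum (taylorCoeff fun t => 1 / g t) p.1 p.2)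
      (atTop ×ˢ 𝓝 x⁻¹) (𝓝 c)) :
    Tendsto (fun p : ℕ × ℂ => fnorm g p.1 p.2) (atTop ×ˢ 𝓝 x) (𝓝 c) := by
  have hinv : Tendsto (fun p : ℕ × ℂ => (p.1, p.2⁻¹)) (atTop ×ˢ 𝓝 x) (atTop ×ˢ 𝓝 x⁻¹) :=
    tendsto_id.prodMap (tendsto_inv₀ hx)
  have hσ : Tendsto (fun p : ℕ × ℂ => (stirlingRatio p.1 : ℂ)) (atTop ×ˢ 𝓝 x) (𝓝 1) := by
    have := (Complex.continuous_ofReal.tendsto _).comp (tendsto_stirlingRatio.comp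
      (tendsto_fst (f := (atTop : Filter ℕ)) (g := 𝓝 x)))
    simpa [Function.comp_def] using this
  have h1 := hσ.mul (h.comp hinv)
  rw [one_mul] at h1
  refine h1.congr' ?_
  filter_upwards [tendsto_fst.eventually (eventually_ne_atTop 0),
    tendsto_snd.eventually (isOpen_ne.mem_nhds hx)] with p hn hp
  exact (fnorm_eq_weightedSum hg hg0 hn hp).symm

lemma logLimitOn_fnorm_zero {g : ℂ → ℂ} (hg : Differentiable ℂ g) (hg0 : g 0 ≠ 0) {U : Set ℂ}
    (h : ∀ x ∈ U, x ≠ 0 ∧ g x⁻¹ ≠ 0 ∧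
      Tendsto (fun p : ℕ × ℂ => weightedSum (taylorCoeff fun t => 1 / g t) p.1 p.2)
        (atTop ×ˢ 𝓝 x⁻¹) (𝓝 (1 / g x⁻¹))) :
    LogLimitOn (fnorm g) (fun _ => 0) U := by
  refine logLimitOn_of_tendsto (fun _ _ => continuousAt_const) (fun x hx => ?_) fun x hx => ?_
  all_goals
    obtain ⟨h1, h2, h3⟩ := h x hx
    have h4 := tendsto_fnorm hg hg0 h1 h3
  · exact h4.eventually_ne (one_div_ne_zero h2)
  · exact tendsto_one_div_mul_log (one_div_ne_zero h2) h4

lemma r0_pos {g : ℂ → ℂ} (hg : Differentiable ℂ g) (hg0 : g 0 ≠ 0)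
    (hZ : (zeros g).Nonempty) : 0 < r0 g := by
  obtain ⟨r, hr, hgr⟩ := Metric.eventually_nhds_iff.1
    (hg.continuous.continuousAt.eventually_ne hg0)
  refine hr.trans_le (le_csInf (hZ.image _) ?_)
  rintro _ ⟨a, ha, rfl⟩
  by_contra! hlt
  exact hgr (by simpa using hlt) ha

lemma r0_le {g : ℂ → ℂ} {a : ℂ} (ha : a ∈ zeros g) : r0 g ≤ ‖a‖ :=
  csInf_le ⟨0, by rintro _ ⟨b, -, rfl⟩; exact norm_nonneg b⟩ ⟨a, ha, rfl⟩

lemma logLimitOn_fnorm_outer {g : ℂ → ℂ} (hg : Differentiable ℂ g) (hg0 : g 0 ≠ 0)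
    (hZ : (zeros g).Nonempty) :
    LogLimitOn (fnorm g) (fun _ => 0) {x : ℂ | 1 / r0 g < ‖x‖} := by
  have hr := r0_pos hg hg0 hZ
  have hne : ∀ t : ℂ, ‖t‖ < r0 g → g t ≠ 0 := fun t ht h => ht.not_ge (r0_le h)
  have hd : DifferentiableOn ℂ (fun t => 1 / g t) (Metric.ball 0 (r0 g)) := fun t ht =>
    ((differentiableAt_const _).div (hg t) (hne t (by simpa using ht))).differentiableWithinAt
  refine logLimitOn_fnorm_zero hg hg0 fun x hx => ?_
  have hx' : 1 / r0 g < ‖x‖ := hx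
  have hx0 : 0 < ‖x‖ := (by positivity : 0 < 1 / r0 g).trans hx'
  have hy : ‖x⁻¹‖ < r0 g := by
    rw [norm_inv, ← one_div]
    exact (one_div_lt hr hx0).1 hx'
  exact ⟨norm_pos_iff.1 hx0, hne _ hy, tendsto_weightedSum_taylorCoeff hd hy⟩

/-- Off D₀ no zero a has both |ax| ≤ 1 and |φ(ax)| ≤ 1. Every pole sum therefore converges to its
pole term, and the partial fractions reassemble to 1/g(1/x). -/
lemma logLimitOn_fnorm_compl_D0 {g : ℂ → ℂ} (hg : Differentiable ℂ g) (hg0 : g 0 ≠ 0) {ρ : ℝ}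
    (hρ : 0 < ρ) : LogLimitOn (fnorm g) (fun _ => 0) ((Metric.ball 0 (1 / ρ))ᶜ \ D0 g) := by
  obtain ⟨R, S, hρR, hS⟩ := exists_radius_finset_zeros hg hg0 ρ
  obtain ⟨m, C, G, -, hG, hpf⟩ := exists_partial_fractions hg hg0 hS
  refine logLimitOn_fnorm_zero hg hg0 fun x hx => ?_
  have hxρ : 1 / ρ ≤ ‖x‖ := by simpa using hx.1
  have hxpos : 0 < ‖x‖ := (by positivity : 0 < 1 / ρ).trans_le hxρ
  have hx0 : x ≠ 0 := norm_pos_iff.1 hxpos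
  have hy : ‖x⁻¹‖ < R := by
    rw [norm_inv, ← one_div]
    exact ((one_div_le hρ hxpos).1 hxρ).trans_lt hρR
  have hreg : ∀ a ∈ zeros g, x⁻¹ / a ∈ saddleRegion := by
    intro a ha
    have ha0 : a ≠ 0 := by
      rintro rfl
      exact hg0 ha
    have hinv : x⁻¹ / a = (a * x)⁻¹ := by rw [mul_inv, div_eq_mul_inv, mul_comm]
    rw [hinv]
    by_cases h1 : ‖a * x‖ ≤ 1
    · refine Or.inr ⟨inv_ne_zero (mul_ne_zero ha0 hx0), ?_⟩
      rw [inv_inv]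
      by_contra! h2
      exact hx.2 (mem_D0_of_zero hg0 ha hx0 h1 h2)
    · left
      rw [norm_inv]
      exact inv_lt_one_of_one_lt₀ (not_le.1 h1)
  -- A zero at 1/x would place the point 1 in `saddleRegion`.
  have hgy : g x⁻¹ ≠ 0 := fun h => by
    refine ne_one_of_mem_saddleRegion (hreg _ h) (div_self (inv_ne_zero hx0))
  refine ⟨hx0, hgy, ?_⟩
  simp_rw [weightedSum_partial_fractions hg hg0 ((norm_nonneg _).trans_lt hy)
    (fun a ha => ((hS a).1 ha).1) hG hpf]
  rw [hpf _ hy hgy]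
  refine (tendsto_weightedSum_taylorCoeff hG hy).add (tendsto_finsetSum _ fun a ha =>
    tendsto_finsetSum _ fun j _ => ?_)
  have hdiv : Tendsto (fun p : ℕ × ℂ => (p.1, p.2 / a)) (atTop ×ˢ 𝓝 x⁻¹)
      (atTop ×ˢ 𝓝 (x⁻¹ / a)) := tendsto_id.prodMap (continuous_id.div_const a).continuousAt
  have := ((tendsto_poleSum j (hreg a ((hS a).1 ha).1)).comp hdiv).const_mul (C a j)
  rwa [mul_one_div] at this

/-- The pole at a, of order m+1, contributes n^m through its leading coefficient and lower powers
through the others. After multiplication by φ(ax)^n, the holomorphic part and the remaining poles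
tend to 0. -/
lemma tendsto_fnorm_mul_phi_pow {g : ℂ → ℂ} (hg : Differentiable ℂ g) (hg0 : g 0 ≠ 0)
    {a x : ℂ} (ha : a ∈ zeros g) (hx : x ≠ 0) (h1 : ‖a * x‖ < 1) (hphi : ‖phi (a * x)‖ < 1)
    (hlt : ∀ b ∈ zeros g, b ≠ a → ‖b * x‖ < 1 → ‖phi (a * x)‖ < ‖phi (b * x)‖) :
    ∃ (m : ℕ) (c : ℂ), c ≠ 0 ∧ Tendsto (fun p : ℕ × ℂ => fnorm g p.1 p.2 * phi (a * p.2) ^ p.1 /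
      ((Real.sqrt (2 * Real.pi * p.1) : ℂ) * (p.1 : ℂ) ^ m)) (atTop ×ˢ 𝓝 x) (𝓝 c) := by
  obtain ⟨R, S, hρR, hS⟩ := exists_radius_finset_zeros hg hg0 ‖x‖⁻¹
  obtain ⟨m, C, G, hC, hG, hpf⟩ := exists_partial_fractions hg hg0 hS
  have hy : ‖x⁻¹‖ < R := by rwa [norm_inv]
  have hxpos : 0 < ‖x‖ := norm_pos_iff.2 hx
  have haS : a ∈ S := by
    refine (hS a).2 ⟨ha, lt_trans ?_ hρR⟩
    rw [norm_mul] at h1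
    rwa [← one_div, lt_div_iff₀ hxpos]
  have hne : ∀ b ∈ zeros g, b ≠ 0 := by
    rintro b hb rfl
    exact hg0 hb
  have hinv : Tendsto (fun p : ℕ × ℂ => (p.1, p.2⁻¹)) (atTop ×ˢ 𝓝 x) (atTop ×ˢ 𝓝 x⁻¹) :=
    tendsto_id.prodMap (tendsto_inv₀ hx)
  have hnx : ∀ᶠ p : ℕ × ℂ in atTop ×ˢ 𝓝 x, p.1 ≠ 0 ∧ p.2 ≠ 0 :=
    (tendsto_fst.eventually (eventually_ne_atTop 0)).and
      (tendsto_snd.eventually (isOpen_ne.mem_nhds hx))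
  have hψ : ContinuousAt (fun x => phi (a * x)) x :=
    (continuous_phi.comp (continuous_const_mul a)).continuousAt
  set M := m a with hM
  have hpow : ∀ k, Tendsto (fun p : ℕ × ℂ => ((p.1 : ℂ)⁻¹) ^ k) (atTop ×ˢ 𝓝 x) (𝓝 (0 ^ k)) :=
    fun k => (tendsto_inv_fst x).pow k
  set c : ℂ := C a M * ((1 - a * x) ^ M / (M.factorial : ℂ)) with hc
  have hreg : Tendsto (fun p : ℕ × ℂ => stirlingFactor p.1 * phi (a * p.2) ^ p.1 *
      weightedSum (taylorCoeff G) p.1 p.2⁻¹ * ((p.1 : ℂ)⁻¹) ^ M) (atTop ×ˢ 𝓝 x) (𝓝 0) := by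
    have h2 := ((tendsto_stirlingFactor_mul_pow 0 hψ hphi).mul
      ((tendsto_weightedSum_taylorCoeff hG hy).comp hinv)).mul (hpow M)
    simpa using h2
  have hpole : ∀ b ∈ S, Tendsto (fun p : ℕ × ℂ => ∑ j ∈ Finset.range (m b + 1), C b j *
      (stirlingFactor p.1 * phi (a * p.2) ^ p.1 * poleSum j p.1 (b * p.2)⁻¹ *
        ((p.1 : ℂ)⁻¹) ^ M)) (atTop ×ˢ 𝓝 x) (𝓝 (if b = a then c else 0)) := by
    intro b hb
    have hbZ : b ∈ zeros g := ((hS b).1 hb).1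
    split_ifs with hba
    · subst hba
      rw [← zero_add c]
      simp_rw [Finset.sum_range_succ]
      have hterm : ∀ j, j ≤ M → Tendsto (fun p : ℕ × ℂ => stirlingFactor p.1 *
          phi (b * p.2) ^ p.1 * poleSum j p.1 (b * p.2)⁻¹ * ((p.1 : ℂ)⁻¹) ^ M) (atTop ×ˢ 𝓝 x)
          (𝓝 ((1 - b * x) ^ j / (j.factorial : ℂ) * 0 ^ (M - j))) := by
        intro j hj
        have hcont : Tendsto (fun p : ℕ × ℂ => (p.1, b * p.2)) (atTop ×ˢ 𝓝 x)
            (atTop ×ˢ 𝓝 (b * x)) := tendsto_id.prodMap (continuous_const_mul b).continuousAt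
        refine (((tendsto_expPoleRatio j h1 hphi).comp hcont).mul (hpow (M - j))).congr' ?_
        filter_upwards [hnx] with p hp
        have h2 := poleSum_inv_eq j hp.1 (mul_ne_zero (hne b hbZ) hp.2)
        rw [← expPoleRatio] at h2
        have h3 : ((p.1 : ℂ)⁻¹) ^ M = ((p.1 : ℂ)⁻¹) ^ j * ((p.1 : ℂ)⁻¹) ^ (M - j) := by
          rw [← pow_add]; congr 1; omega
        simp only [Function.comp_apply]
        rw [h2, h3, inv_pow, div_eq_mul_inv]
        ring
      refine Tendsto.add ?_ ?_
      · rw [← Finset.sum_const_zero (s := Finset.range (m b))]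
        refine tendsto_finsetSum _ fun j hj => ?_
        have hj' : j < M := Finset.mem_range.1 hj
        have h2 := (hterm j hj'.le).const_mul (C b j)
        rwa [zero_pow (Nat.sub_ne_zero_of_lt hj'), mul_zero, mul_zero] at h2
      · have h2 := (hterm M le_rfl).const_mul (C b M)
        rwa [Nat.sub_self, pow_zero, mul_one] at h2
    · rw [← Finset.sum_const_zero (s := Finset.range (m b + 1))]
      refine tendsto_finsetSum _ fun j _ => ?_
      have h2 := ((tendsto_pow_mul_poleSum j (hne b hbZ) hx hψ hphi
        (hlt b hbZ hba)).mul (hpow M)).const_mul (C b j)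
      simpa using h2
  refine ⟨M, c, ?_, ?_⟩
  · refine mul_ne_zero (hC a haS) (div_ne_zero (pow_ne_zero _ ?_)
      (by exact_mod_cast M.factorial_ne_zero))
    rw [sub_ne_zero]
    intro h
    simp [← h] at h1
  · have h2 := hreg.add (tendsto_finsetSum S hpole)
    rw [Finset.sum_ite_eq' S a, if_pos haS, zero_add] at h2
    refine h2.congr' ?_
    filter_upwards [hnx] with p hp
    have hs : (Real.sqrt (2 * Real.pi * p.1) : ℂ) ≠ 0 := by
      have : 0 < (p.1 : ℝ) := by exact_mod_cast Nat.pos_of_ne_zero hp.1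
      exact_mod_cast (by positivity : 0 < Real.sqrt (2 * Real.pi * p.1)).ne'
    have hn : (p.1 : ℂ) ≠ 0 := by exact_mod_cast hp.1
    have h3 : ∀ b : ℂ, p.2⁻¹ / b = (b * p.2)⁻¹ := fun b => by
      rw [mul_inv, div_eq_mul_inv, mul_comm]
    have h4 : ∑ b ∈ S, ∑ j ∈ Finset.range (m b + 1), C b j *
        (stirlingFactor p.1 * phi (a * p.2) ^ p.1 * poleSum j p.1 (b * p.2)⁻¹ *
          ((p.1 : ℂ)⁻¹) ^ M) = stirlingFactor p.1 * phi (a * p.2) ^ p.1 *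
          (∑ b ∈ S, ∑ j ∈ Finset.range (m b + 1), C b j * poleSum j p.1 (p.2⁻¹ / b)) *
          ((p.1 : ℂ)⁻¹) ^ M := by
      simp_rw [Finset.mul_sum, Finset.sum_mul, h3]
      refine Finset.sum_congr rfl fun b _ => Finset.sum_congr rfl fun j _ => ?_
      ring
    rw [h4, fnorm_eq_weightedSum hg hg0 hp.1 hp.2, weightedSum_partial_fractions hg hg0
      ((norm_nonneg _).trans_lt hy) (fun a ha => ((hS a).1 ha).1) hG hpf, stirlingRatio_eq,
      inv_pow]
    push_cast
    field_simp

lemma tendsto_one_div_mul_log_sqrt_mul_pow (m : ℕ) :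
    Tendsto (fun n : ℕ => 1 / (n : ℝ) * Real.log (Real.sqrt (2 * Real.pi * n) * (n : ℝ) ^ m))
      atTop (𝓝 0) := by
  have h1 : Tendsto (fun n : ℕ => Real.log n / (n : ℝ)) atTop (𝓝 0) :=
    Real.isLittleO_log_id_atTop.tendsto_div_nhds_zero.comp tendsto_natCast_atTop_atTop
  have h2 := ((tendsto_one_div_atTop_nhds_zero_nat (𝕜 := ℝ)).const_mul
    (Real.log (2 * Real.pi) / 2)).add (h1.const_mul (1 / 2 + m : ℝ))
  simp only [mul_zero, add_zero] at h2
  refine h2.congr' ?_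
  filter_upwards [eventually_ne_atTop 0] with n hn
  have hn' : 0 < (n : ℝ) := by positivity
  have hpi : 0 < 2 * Real.pi := by positivity
  have hs : Real.sqrt (2 * Real.pi * n) ≠ 0 := by positivity
  rw [Real.log_mul hs (pow_ne_zero _ hn'.ne'), Real.log_sqrt (by positivity),
    Real.log_mul hpi.ne' hn'.ne', Real.log_pow]
  ring

lemma logLimitOn_fnorm_Da {g : ℂ → ℂ} (hg : Differentiable ℂ g) (hg0 : g 0 ≠ 0) {a : ℂ}
    (ha : IsDominant g a) :
    LogLimitOn (fnorm g) (fun x => -Real.log ‖phi (a * x)‖) (interior (Da g a) \ {0}) := by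
  have hne : ∀ b ∈ zeros g, b ≠ 0 := by
    rintro b hb rfl
    exact hg0 hb
  have ha0 := hne a ha.1
  have key : ∀ x ∈ interior (Da g a) \ {0}, x ≠ 0 ∧ ∃ (m : ℕ) (c : ℂ), c ≠ 0 ∧
      Tendsto (fun p : ℕ × ℂ => fnorm g p.1 p.2 * phi (a * p.2) ^ p.1 /
      ((Real.sqrt (2 * Real.pi * p.1) : ℂ) * (p.1 : ℂ) ^ m)) (atTop ×ˢ 𝓝 x) (𝓝 c) := by
    rintro x ⟨hx, hx0 : x ≠ 0⟩
    obtain ⟨h1, h2⟩ := norm_lt_one_of_mem_interior_Da hx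
    refine ⟨hx0, tendsto_fnorm_mul_phi_pow hg hg0 ha.1 hx0 h1 h2 fun b hb hba hbx => ?_⟩
    by_cases hd : IsDominant g b
    · exact norm_phi_lt_of_mem_interior_Da ha0 hd hba hx0 hx
    -- A non-dominant b either has |φ(bx)| > 1 > |φ(ax)|, or is strictly outweighed by a dominant
    -- zero, possibly a itself.
    · rcases lt_or_ge 1 ‖phi (b * x)‖ with h3 | h3
      · exact h2.trans h3
      · obtain ⟨b', hb', -, h4⟩ := exists_isDominant_norm_phi_lt hg0 hb hd hx0 hbx.le h3
        refine lt_of_le_of_lt ?_ h4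
        by_cases hba' : b' = a
        · rw [hba']
        · exact (interior_subset hx).2.1 b' hb' hba'
  have hcont : ∀ x : ℂ, x ≠ 0 → ContinuousAt (fun x => -Real.log ‖phi (a * x)‖) x := fun x hx0 =>
    (((continuous_phi.comp (continuous_const_mul a)).norm.continuousAt).log
      (norm_ne_zero_iff.2 (phi_ne_zero (mul_ne_zero ha0 hx0)))).neg
  refine logLimitOn_of_tendsto (fun x hx => hcont x (key x hx).1) (fun x hx => ?_) fun x hx => ?_
  all_goals
    obtain ⟨hx0, m, c, hc, hlim⟩ := key x hx
  · filter_upwards [hlim.eventually_ne hc] with p hp h0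
    rw [h0, zero_mul, zero_div] at hp
    exact hp rfl
  · have h1 := tendsto_one_div_mul_log (f := fun n x => fnorm g n x * phi (a * x) ^ n /
      ((Real.sqrt (2 * Real.pi * n) : ℂ) * (n : ℂ) ^ m)) hc hlim
    have h2 := (tendsto_one_div_mul_log_sqrt_mul_pow m).comp
      (tendsto_fst (f := (atTop : Filter ℕ)) (g := 𝓝 x))
    have h3 := (h1.add h2).add ((hcont x hx0).tendsto.comp
      (tendsto_snd (f := (atTop : Filter ℕ)) (g := 𝓝 x)))
    simp only [add_zero, zero_add] at h3
    refine h3.congr' ?_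
    filter_upwards [hlim.eventually_ne hc, tendsto_fst.eventually (eventually_ne_atTop 0),
      tendsto_snd.eventually (isOpen_ne.mem_nhds hx0)] with p hp hn hpx
    have hn' : 0 < (p.1 : ℝ) := by exact_mod_cast Nat.pos_of_ne_zero hn
    have hs : 0 < Real.sqrt (2 * Real.pi * p.1) * (p.1 : ℝ) ^ m := by positivity
    have hph : ‖phi (a * p.2)‖ ≠ 0 := norm_ne_zero_iff.2 (phi_ne_zero (mul_ne_zero ha0 hpx))
    have hf : ‖fnorm g p.1 p.2‖ ≠ 0 := by
      intro h0
      rw [norm_eq_zero.1 h0, zero_mul, zero_div] at hp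
      exact hp rfl
    have h4 : ‖fnorm g p.1 p.2 * phi (a * p.2) ^ p.1 /
        ((Real.sqrt (2 * Real.pi * p.1) : ℂ) * (p.1 : ℂ) ^ m)‖ =
        ‖fnorm g p.1 p.2‖ * ‖phi (a * p.2)‖ ^ p.1 /
          (Real.sqrt (2 * Real.pi * p.1) * (p.1 : ℝ) ^ m) := by
      rw [norm_div, norm_mul, norm_mul, norm_pow, norm_pow, Complex.norm_natCast,
        Complex.norm_real, Real.norm_of_nonneg (Real.sqrt_nonneg _)]
    simp only [Function.comp_apply]
    rw [h4, Real.log_div (mul_ne_zero hf (pow_ne_zero _ hph)) hs.ne',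
      Real.log_mul hf (pow_ne_zero _ hph), Real.log_pow]
    field_simp
    ring

lemma LogLimitOn.mono {f : ℕ → ℂ → ℂ} {L : ℂ → ℝ} {U V : Set ℂ} (h : LogLimitOn f L V)
    (hUV : U ⊆ V) : LogLimitOn f L U := fun K hK => h K (hK.trans hUV)

end

end AppellSzego

theorem proposition7p1 (g : ℂ → ℂ) (hg : Differentiable ℂ g) (hg0 : g 0 ≠ 0)
    (hZ : (AppellSzego.zeros g).Nonempty)
    (ρ : ℝ) (hρ : 0 < ρ) (hρZ : ∀ a ∈ AppellSzego.zeros g, ‖a‖ ≠ ρ)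
    (hρD : Metric.closedBall (0 : ℂ) (1 / ρ) ⊆ interior (AppellSzego.D0 g))
    (δ : ℂ → ℝ) (hδ : ∀ a ∈ AppellSzego.zeros g, ‖a‖ < ρ → 0 < δ a)
    (hδd : ∀ a ∈ AppellSzego.zeros g, ∀ b ∈ AppellSzego.zeros g, ‖a‖ < ρ → ‖b‖ < ρ → a ≠ b →
      Disjoint (Metric.ball (1 / a) (δ a)) (Metric.ball (1 / b) (δ b))) :
    AppellSzego.LogLimitOn (AppellSzego.fnorm g) (fun _ => 0)
        {x : ℂ | 1 / AppellSzego.r0 g < ‖x‖} ∧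
    AppellSzego.LogLimitOn (AppellSzego.fnorm g) (fun _ => 0)
        (AppellSzego.Rrho g ρ δ \ AppellSzego.D0 g) ∧
    ∀ a : ℂ, AppellSzego.IsDominant g a →
      AppellSzego.LogLimitOn (AppellSzego.fnorm g)
        (fun x => -Real.log ‖AppellSzego.phi (a * x)‖)
        (interior (AppellSzego.Da g a) ∩ {x : ℂ | 1 / ρ < ‖x‖}) := by
  refine ⟨AppellSzego.logLimitOn_fnorm_outer hg hg0 hZ,
    (AppellSzego.logLimitOn_fnorm_compl_D0 hg hg0 hρ).mono ?_,
    fun a ha => (AppellSzego.logLimitOn_fnorm_Da hg hg0 ha).mono ?_⟩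
  · rintro x ⟨⟨-, hx⟩, hxD⟩
    exact ⟨fun h => hx (Or.inr h), hxD⟩
  · rintro x ⟨hx, hxρ : 1 / ρ < ‖x‖⟩
    exact ⟨hx, norm_pos_iff.1 ((by positivity : 0 < 1 / ρ).trans hxρ)⟩
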